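/- Let $g,p\ge 0$ be integers and let $F=F_{g,p}$ be the free group with basis $t_1,\dots,t_p,x_1,\dots,x_g,y_1,\dots,y_g$. Write $\overline u=u^{-1}$ and let $|u|$ denote reduced word length. Homomorphisms act on the right, as exponents. The $t$-letters are the $t_j$; the $x$-letters are the $x_i,\overline x_i,y_i,\overline y_i$; letters are the $t_j,\overline t_j$ and the $x$-letters. Let $v_1,\dots,v_{4g+p}$ be a listing, without repetition, of all $t$-letters and all $x$-letters. Let $\Gamma$ be the graph whose vertices are all the letters and whose oriented edges are $(\overline t_j\rightsquigarrow t_j)$ for $1\le j\le p$ and $(v_k\rightsquigarrow\overline v_{k+1})$ for $1\le k\le 4g+p-1$. If $\Gamma$ has no cycles (orientations being ignored; a loop, or two distinct edges joining the same two vertices, counts as a cycle), then $V=v_1v_2\cdots v_{4g+p}\in F$ is called a Zieschang element. The Zieschang groupoid $\mathcal Z_{g,p}$ has the Zieschang elements as objects. Its edges $V\xrightarrow{\phi}W$ are the automorphisms $\phi$ of $F$ which map the set of conjugacy classes $\{[t_1],\dots,[t_p]\}$ onto itself and satisfy $V^\phi=W$; multiplication is composition. An edge $V\xrightarrow{\phi}W$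 of $\mathcal Z_{g,p}$ with $V=v_1\cdots v_{4g+p}$ as above is a Nielsen edge if one of the following holds. 1. $\phi$ permutes the $t$-letters and permutes the $x$-letters. 2. For some $k$, $v_k$ is an $x$-letter, $\phi$ fixes all letters other than $v_k^{\pm1}$, and either $v_k^\phi=v_k\overline v_{k+1}$ (with $k<4g+p$) or $v_k^\phi=\overline v_{k-1}v_k$ (with $k>1$). 3. For some $k$, $v_k$ is a $t$-letter, $\phi$ fixes all letters other than $v_k^{\pm1}$, and either $v_k^\phi=v_{k+1}v_k\overline v_{k+1}$ (with $k<4g+p$) or $v_k^\phi=\overline v_{k-1}v_kv_{k-1}$ (with $k>1$). The Nielsen subgraph $\mathcal N_{g,p}$ of $\mathcal Z_{g,p}$ has all the Zieschang elements as vertices and the Nielsen edges as edges. **Theorem.** Let $V,W\in F_{g,p}$, let $H$ be a free group, and let $\phi$ be an endomorphism of the free product $H*F_{g,p}$. Suppose that: (a) $V$ is a Zieschang element; (b) $|W|\le 4g+p$; (c) $V^\phi=W$; (d) there is a permutation $\pi$ of $\{1,\dots,p\}$ such that, for each $j$, $t_j^\phi$ is conjugate in $H*F_{g,p}$ to $t_{\pi(j)}$;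 (e) the image $F_{g,p}^{\phi}$ is isomorphic to $F_{g,p}$. Then $W$ is a Zieschang element, and there exists an edge $V\xrightarrow{\phi'}W$ in the subgroupoid of $\mathcal Z_{g,p}$ generated by $\mathcal N_{g,p}$ such that $\phi$ acts on the free factor $F_{g,p}$ as $\phi'$. In particular, $\mathcal Z_{g,p}$ is generated by $\mathcal N_{g,p}$. -/

import Mathlib

open CategoryTheory

namespace ZMC

/-- The distinguished basis `t_1, …, t_p, x_1, …, x_g, y_1, …, y_g` (indices shifted to start
at `0`). -/
inductive Gen (g p : ℕ) : Type
  | t (j : Fin p) : Gen g p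
  | x (i : Fin g) : Gen g p
  | y (i : Fin g) : Gen g p
  deriving DecidableEq

/-- The free group `F_{g,p}`, of rank `2g + p`, with its distinguished basis. -/
abbrev F (g p : ℕ) : Type := FreeGroup (Gen g p)

/-- The basis elements and their formal inverses: `(b, true)` stands for `b` and `(b, false)`
for `b⁻¹`. -/
abbrev Letter (g p : ℕ) : Type := Gen g p × Bool

namespace Letter

variable {g p : ℕ}

/-- The inverse letter. -/
def inv (l : Letter g p) : Letter g p := (l.1, !l.2)

/-- The element of `F_{g,p}` that a letter denotes. -/
def elt (l : Letter g p) : F g p := FreeGroup.mk [l]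

end Letter

/-- The `t`-letters `t_1, …, t_p`; their inverses are excluded. -/
def tLetters (g p : ℕ) : Set (Letter g p) := {l | ∃ j : Fin p, l = (Gen.t j, true)}

/-- The `x`-letters: all `x_i`, `y_i` and their inverses. -/
def xLetters (g p : ℕ) : Set (Letter g p) :=
  {l | ∃ (i : Fin g) (b : Bool), l = (Gen.x i, b) ∨ l = (Gen.y i, b)}

/-- A set `E` of oriented edges on the vertex set `X` has no cycles when orientations are
ignored. A cycle of length `n + 1` consists of `n + 1` distinct vertices and `n + 1` distinct
edges such that the `i`-th edge joins the `i`-th vertex to the next one, cyclically. So a loop is a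
cycle of length one, and two edges joining the same two vertices form a cycle of length two. -/
def IsForest {X : Type*} (E : Set (X × X)) : Prop :=
  ¬ ∃ (n : ℕ) (u : Fin (n + 1) → X) (e : Fin (n + 1) → X × X),
    Function.Injective u ∧ Function.Injective e ∧
      ∀ i, e i ∈ E ∧ (e i = (u i, u (i + 1)) ∨ e i = (u (i + 1), u i))

/-- The edge set of the extended Whitehead graph of a sequence `v` of letters. Its vertex set
consists of all letters; its edges are `t_j⁻¹ ⇝ t_j` and `v_k ⇝ v_{k+1}⁻¹`. -/
def whiteheadEdges {g p : ℕ} (v : Fin (4 * g + p) → Letter g p) :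
    Set (Letter g p × Letter g p) :=
  {e | ∃ j : Fin p, e = ((Gen.t j, false), (Gen.t j, true))} ∪
  {e | ∃ k l : Fin (4 * g + p), (l : ℕ) = k + 1 ∧ e = (v k, (v l).inv)}

/-- `v` lists every `t`-letter and every `x`-letter exactly once, the product is `V`, and the
extended Whitehead graph is a forest. -/
structure IsZieschangSeq {g p : ℕ} (v : Fin (4 * g + p) → Letter g p) (V : F g p) : Prop where
  bijOn : Set.BijOn v Set.univ (tLetters g p ∪ xLetters g p)
  prod_eq : (List.ofFn fun k => (v k).elt).prod = V
  forest : IsForest (whiteheadEdges v)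

/-- Zieschang elements of `F_{g,p}`. -/
def IsZieschang {g p : ℕ} (V : F g p) : Prop := ∃ v, IsZieschangSeq v V

/-- The set of conjugacy classes `{[t_1], …, [t_p]}` of `F_{g,p}`. -/
def tClasses (g p : ℕ) : Set (ConjClasses (F g p)) :=
  {c | ∃ j : Fin p, c = ConjClasses.mk (FreeGroup.of (Gen.t j))}

/-- `φ` stabilizes (hence permutes) the set of conjugacy classes `{[t_1], …, [t_p]}`. -/
def StabilizesT {g p : ℕ} (φ : MulAut (F g p)) : Prop :=
  ConjClasses.map φ.toMonoidHom '' tClasses g p = tClasses g p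

/-- The objects of the Zieschang groupoid: the Zieschang elements. -/
@[ext]
structure Zieschang (g p : ℕ) : Type where
  elt : F g p
  isZieschang : IsZieschang elt

/-- The edges `V ⟶ W` of the Zieschang groupoid. -/
@[ext]
structure ZieschangHom {g p : ℕ} (V W : Zieschang g p) : Type where
  aut : MulAut (F g p)
  stabilizes : StabilizesT aut
  map_elt : aut V.elt = W.elt

theorem StabilizesT.refl {g p : ℕ} : StabilizesT (MulEquiv.refl (F g p) : MulAut (F g p)) := by
  have h : ConjClasses.map (MulEquiv.toMonoidHom (MulEquiv.refl (F g p))) = id := by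
    funext c
    obtain ⟨a, rfl⟩ := ConjClasses.exists_rep c
    rfl
  simp only [StabilizesT, h, Set.image_id]

theorem StabilizesT.trans {g p : ℕ} {φ ψ : MulAut (F g p)} (hφ : StabilizesT φ)
    (hψ : StabilizesT ψ) : StabilizesT (MulEquiv.trans φ ψ : MulAut (F g p)) := by
  have h : ConjClasses.map (MulEquiv.toMonoidHom (MulEquiv.trans φ ψ)) =
      ConjClasses.map ψ.toMonoidHom ∘ ConjClasses.map φ.toMonoidHom := by
    funext c
    obtain ⟨a, rfl⟩ := ConjClasses.exists_rep c
    rfl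
  unfold StabilizesT at *
  rw [h, Set.image_comp, hφ, hψ]

theorem StabilizesT.symm {g p : ℕ} {φ : MulAut (F g p)} (hφ : StabilizesT φ) :
    StabilizesT (MulEquiv.symm φ : MulAut (F g p)) := by
  have h : ConjClasses.map (MulEquiv.toMonoidHom (MulEquiv.symm φ)) ∘
      ConjClasses.map φ.toMonoidHom = id := by
    funext c
    obtain ⟨a, rfl⟩ := ConjClasses.exists_rep c
    exact congrArg ConjClasses.mk (φ.symm_apply_apply a)
  unfold StabilizesT at *
  conv_lhs => rw [← hφ]
  rw [← Set.image_comp, h, Set.image_id]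

/-- The Zieschang groupoid. Automorphisms act on the right, so the composite of
`φ : U ⟶ V` and `ψ : V ⟶ W` applies first `φ`, then `ψ`. -/
instance (g p : ℕ) : Groupoid (Zieschang g p) where
  Hom V W := ZieschangHom V W
  id V := ⟨MulEquiv.refl _, StabilizesT.refl, rfl⟩
  comp φ ψ := ⟨MulEquiv.trans φ.aut ψ.aut, φ.stabilizes.trans ψ.stabilizes,
    (congrArg ψ.aut φ.map_elt).trans ψ.map_elt⟩
  inv φ := ⟨MulEquiv.symm φ.aut, φ.stabilizes.symm,
    φ.aut.symm_apply_eq.2 φ.map_elt.symm⟩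
  inv_comp φ := ZieschangHom.ext (MulEquiv.symm_trans_self φ.aut)
  comp_inv φ := ZieschangHom.ext (MulEquiv.self_trans_symm φ.aut)

/-- `φ` fixes every letter other than `l` and its inverse. -/
def FixesOthers {g p : ℕ} (φ : MulAut (F g p)) (l : Letter g p) : Prop :=
  ∀ m : Letter g p, m ≠ l → m ≠ l.inv → φ m.elt = m.elt

/-- `φ` permutes the `t`-letters and permutes the `x`-letters. -/
def IsN1 {g p : ℕ} (φ : MulAut (F g p)) : Prop :=
  φ '' (Letter.elt '' tLetters g p) = Letter.elt '' tLetters g p ∧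
  φ '' (Letter.elt '' xLetters g p) = Letter.elt '' xLetters g p

/-- Right: `φ` is `v_k ↦ v_k v_{k+1}⁻¹`; left: `φ` is `v_k ↦ v_{k-1}⁻¹ v_k`; here `v_k` is an
`x`-letter in the expression of `V`, and all other basis elements are fixed. -/
def IsN2 {g p : ℕ} (V : F g p) (φ : MulAut (F g p)) : Prop :=
  ∃ v : Fin (4 * g + p) → Letter g p, IsZieschangSeq v V ∧
    ∃ k l : Fin (4 * g + p), v k ∈ xLetters g p ∧ FixesOthers φ (v k) ∧
      (((l : ℕ) = k + 1 ∧ φ (v k).elt = (v k).elt * ((v l).elt)⁻¹) ∨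
       ((l : ℕ) + 1 = k ∧ φ (v k).elt = ((v l).elt)⁻¹ * (v k).elt))

/-- Right: `φ` is `v_k ↦ v_{k+1} v_k v_{k+1}⁻¹`; left: `φ` is `v_k ↦ v_{k-1}⁻¹ v_k v_{k-1}`;
here `v_k` is a `t`-letter in the expression of `V`, and all other basis elements are fixed. -/
def IsN3 {g p : ℕ} (V : F g p) (φ : MulAut (F g p)) : Prop :=
  ∃ v : Fin (4 * g + p) → Letter g p, IsZieschangSeq v V ∧
    ∃ k l : Fin (4 * g + p), v k ∈ tLetters g p ∧ FixesOthers φ (v k) ∧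
      (((l : ℕ) = k + 1 ∧ φ (v k).elt = (v l).elt * (v k).elt * ((v l).elt)⁻¹) ∨
       ((l : ℕ) + 1 = k ∧ φ (v k).elt = ((v l).elt)⁻¹ * (v k).elt * (v l).elt))

/-- The Nielsen subgraph of the Zieschang groupoid: its edges `V ⟶ W` are the Nielsen edges. -/
def nielsen (g p : ℕ) (V W : Zieschang g p) : Set (V ⟶ W) :=
  {φ : ZieschangHom V W | IsN1 φ.aut ∨ IsN2 V.elt φ.aut ∨ IsN3 V.elt φ.aut}

/-- The subgroupoid of the Zieschang groupoid generated by the Nielsen subgraph. -/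
def nielsenSubgroupoid (g p : ℕ) : Subgroupoid (Zieschang g p) :=
  Subgroupoid.generated (nielsen g p)

end ZMC

/-! The proof is Nielsen reduction, controlled by the Whitehead graph. Since `F` is Hopfian
(`injective_of_range_equiv`), `φ` is injective on `F`; since `H * F` embeds in a free group,
everything reduces to `exists_nielsen_path`: an injective `θ : F → FreeGroup X` that sends `V` to a
short element of an embedded copy of `F`.

In a Whitehead graph every vertex has at most one edge in and one edge out, and only the last letter
has none out. So being a forest, being a single path and being connected are the same, and
connectedness can be tested by predicates constant along edges. A Nielsen edge of kind 2 or 3 only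
relocates one or two consecutive vertices of that path, hence leads to a Zieschang element again.

Rank each letter by the reduced word of its `θ`-image: by length, then by the last half. If a
Nielsen edge `ψ : V → V'` between neighbouring letters improves this rank for the letter it changes,
replace `θ, V` by `θ ψ⁻¹, V'`. Ranks are compared pointwise as functions from finitely many letters
to ordinals, so this stops.

When no edge helps, neighbours cancel at most half of one another, and each image has the form
`c_k⁻¹ m_k c_{k+1}` with `m_k` nonempty and no cancellation between the `m_k` (`exists_staircase`).
As `|W| ≤ 4g + p`, every `m_k` is one letter. Attaching `c_{k+1}` to the vertex `v_k` and `c_k` to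
`v_k⁻¹` is consistent and constant along edges; the graph is connected and the last value is empty,
so all `c_k` are empty. Then `θ` permutes letters, which is a Nielsen edge of kind 1. -/

namespace ZMC

variable {g p : ℕ}

/-- The letters of the words considered: all `t`-letters and all `x`-letters. -/
abbrev posLetters (g p : ℕ) : Set (Letter g p) := tLetters g p ∪ xLetters g p

/-! ### Letters and their inverses -/

namespace Letter

@[simp] theorem inv_inv (z : Letter g p) : z.inv.inv = z := by simp [inv]

theorem inv_ne (z : Letter g p) : z.inv ≠ z := by
  intro h
  have := congrArg Prod.snd h
  simp [inv] at this

theorem inv_injective : Function.Injective (inv : Letter g p → Letter g p) :=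
  Function.LeftInverse.injective inv_inv

theorem inv_eq_iff {y z : Letter g p} : y.inv = z ↔ y = z.inv :=
  ⟨fun h => by rw [← h, inv_inv], fun h => by rw [h, inv_inv]⟩

theorem elt_inv (z : Letter g p) : z.inv.elt = z.elt⁻¹ := by
  simp [elt, inv, FreeGroup.inv_mk, FreeGroup.invRev]

theorem inv_mem_xLetters {z : Letter g p} (hz : z ∈ xLetters g p) : z.inv ∈ xLetters g p := by
  obtain ⟨i, b, rfl | rfl⟩ := hz
  · exact ⟨i, !b, Or.inl rfl⟩
  · exact ⟨i, !b, Or.inr rfl⟩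

theorem inv_notMem_of_mem_tLetters {z : Letter g p} (hz : z ∈ tLetters g p) :
    z.inv ∉ posLetters g p := by
  obtain ⟨j, rfl⟩ := hz
  rintro (⟨i, hi⟩ | ⟨i, b, hi | hi⟩) <;> simp [inv] at hi

theorem notMem_tLetters_of_mem_xLetters {z : Letter g p} (hz : z ∈ xLetters g p) :
    z ∉ tLetters g p := by
  obtain ⟨i, b, rfl | rfl⟩ := hz <;> rintro ⟨j, hj⟩ <;> simp at hj

end Letter

instance : Finite (Gen g p) :=
  Finite.of_injective
    (fun y : Gen g p => match y with
      | .t j => (Sum.inl j : Fin p ⊕ (Fin g ⊕ Fin g))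
      | .x i => Sum.inr (Sum.inl i)
      | .y i => Sum.inr (Sum.inr i))
    (by rintro (a | a | a) (b | b | b) h <;> simp_all)

/-! ### Zieschang elements as lists with connected Whitehead graph -/

/-- A property of letters is constant along the Whitehead edge between two consecutive letters
of a list. -/
def EdgeInvariant (S : Letter g p → Prop) (a b : Letter g p) : Prop := S a ↔ S b.inv

/-- The extended Whitehead graph of a list of letters is connected. -/
def WhiteheadConnected (L : List (Letter g p)) : Prop :=
  ∀ S : Letter g p → Prop, (∀ z ∈ tLetters g p, (S z.inv ↔ S z)) →
    L.IsChain (EdgeInvariant S) → ∀ y z, (S y ↔ S z)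

/-- A list of letters whose product is a Zieschang element. -/
structure IsZieschangList (L : List (Letter g p)) : Prop where
  nodup : L.Nodup
  mem_iff : ∀ z, z ∈ L ↔ z ∈ posLetters g p
  length_eq : L.length = 4 * g + p
  connected : WhiteheadConnected L

/-- The element of the free group that a list of letters spells. -/
def listElt (L : List (Letter g p)) : F g p := (L.map Letter.elt).prod

/-! ### A Whitehead graph is a forest exactly when it is connected -/

section Forest

variable {v : Fin (4 * g + p) → Letter g p}

theorem whiteheadEdges_out_unique (hv : Set.BijOn v Set.univ (posLetters g p))
    {y z z' : Letter g p} (h : (y, z) ∈ whiteheadEdges v) (h' : (y, z') ∈ whiteheadEdges v) :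
    z = z' := by
  have key : ∀ (j : Fin p) k, ((Gen.t j, false) : Letter g p) ≠ v k := by
    intro j k hk
    refine Letter.inv_notMem_of_mem_tLetters (g := g) (z := (Gen.t j, true)) ⟨j, rfl⟩ ?_
    change ((Gen.t j, false) : Letter g p) ∈ _
    rw [hk]
    exact hv.mapsTo (Set.mem_univ k)
  rcases h with ⟨j, hj⟩ | ⟨k, l, hkl, hj⟩ <;> rcases h' with ⟨j', hj'⟩ | ⟨k', l', hkl', hj'⟩ <;>
    simp only [Prod.mk.injEq] at hj hj'
  · obtain ⟨rfl, rfl⟩ := hj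
    obtain ⟨h1, rfl⟩ := hj'
    simp at h1
    rw [h1]
  · exact absurd (hj.1.symm.trans hj'.1) (key _ _)
  · exact absurd (hj'.1.symm.trans hj.1) (key _ _)
  · have : k = k' := hv.injOn (Set.mem_univ _) (Set.mem_univ _) (hj.1.symm.trans hj'.1)
    have : l = l' := Fin.ext (by omega)
    rw [hj.2, hj'.2, this]

theorem whiteheadEdges_in_unique (hv : Set.BijOn v Set.univ (posLetters g p))
    {y z z' : Letter g p} (h : (z, y) ∈ whiteheadEdges v) (h' : (z', y) ∈ whiteheadEdges v) :
    z = z' := by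
  have key : ∀ (j : Fin p) k, ((Gen.t j, true) : Letter g p) ≠ (v k).inv := by
    intro j k hk
    refine Letter.inv_notMem_of_mem_tLetters (g := g) (z := (Gen.t j, true)) ⟨j, rfl⟩ ?_
    rw [hk, Letter.inv_inv]
    exact hv.mapsTo (Set.mem_univ k)
  rcases h with ⟨j, hj⟩ | ⟨k, l, hkl, hj⟩ <;> rcases h' with ⟨j', hj'⟩ | ⟨k', l', hkl', hj'⟩ <;>
    simp only [Prod.mk.injEq] at hj hj'
  · obtain ⟨rfl, rfl⟩ := hj
    obtain ⟨rfl, h1⟩ := hj'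
    simp at h1
    rw [h1]
  · exact absurd (hj.2.symm.trans hj'.2) (key _ _)
  · exact absurd (hj'.2.symm.trans hj.2) (key _ _)
  · have : l = l' := hv.injOn (Set.mem_univ _) (Set.mem_univ _)
      (Letter.inv_injective (hj.2.symm.trans hj'.2))
    have : k = k' := Fin.ext (by omega)
    rw [hj.1, hj'.1, this]

theorem isChain_ofFn_iff {S : Letter g p → Prop} {n : ℕ} {v : Fin n → Letter g p} :
    (List.ofFn v).IsChain (EdgeInvariant S) ↔
      ∀ k l : Fin n, (l : ℕ) = k + 1 → (S (v k) ↔ S (v l).inv) := by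
  rw [List.isChain_iff_getElem]
  constructor
  · intro h k l hkl
    have := h k (by simp; omega)
    simp only [EdgeInvariant, List.getElem_ofFn] at this
    rw [this]
    have e : (⟨(k : ℕ) + 1, by omega⟩ : Fin n) = l := Fin.ext hkl.symm
    rw [e]
  · intro h i hi
    simp only [List.length_ofFn] at hi
    simp only [EdgeInvariant, List.getElem_ofFn]
    exact h ⟨i, by omega⟩ ⟨i + 1, hi⟩ rfl

theorem edge_iff_of_invariant {S : Letter g p → Prop} (ht : ∀ z ∈ tLetters g p, (S z.inv ↔ S z))
    (hc : (List.ofFn v).IsChain (EdgeInvariant S)) {y z : Letter g p}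
    (h : (y, z) ∈ whiteheadEdges v) : S y ↔ S z := by
  rcases h with ⟨j, hj⟩ | ⟨k, l, hkl, hj⟩
  · obtain ⟨rfl, rfl⟩ := Prod.mk.inj hj
    exact ht (Gen.t j, true) ⟨j, rfl⟩
  · obtain ⟨rfl, rfl⟩ := Prod.mk.inj hj
    exact isChain_ofFn_iff.1 hc k l hkl

/-- A forest on the letters is a single path. -/
theorem whiteheadConnected_of_isForest (hv : Set.BijOn v Set.univ (posLetters g p))
    (hf : IsForest (whiteheadEdges v)) : WhiteheadConnected (List.ofFn v) := by
  intro S ht hc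
  rcases Nat.eq_zero_or_pos (4 * g + p) with h0 | hpos
  · intro y
    have : g = 0 := by omega
    have : p = 0 := by omega
    subst g p
    obtain ⟨j | i | i, b⟩ := y
    · exact j.elim0
    · exact i.elim0
    · exact i.elim0
  set last : Letter g p := v ⟨4 * g + p - 1, by omega⟩ with hlast
  have hsucc : ∀ z : Letter g p, ∃ y, z ≠ last → (z, y) ∈ whiteheadEdges v := by
    intro z
    by_cases hz : z ∈ posLetters g p
    · obtain ⟨k, -, rfl⟩ := hv.surjOn hz
      by_cases hk : (k : ℕ) + 1 < 4 * g + p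
      · exact ⟨_, fun _ => Or.inr ⟨k, ⟨k + 1, hk⟩, rfl, rfl⟩⟩
      · refine ⟨last, fun h => absurd ?_ h⟩
        rw [hlast]
        congr 1
        apply Fin.ext
        simp only
        omega
    · obtain ⟨j | i | i, b⟩ := z
      · cases b
        · exact ⟨_, fun _ => Or.inl ⟨j, rfl⟩⟩
        · exact absurd (Or.inl ⟨j, rfl⟩) hz
      · exact absurd (Or.inr ⟨i, b, Or.inl rfl⟩) hz
      · exact absurd (Or.inr ⟨i, b, Or.inr rfl⟩) hz
  choose f hf' using hsucc
  -- Following outgoing edges among finitely many letters must become periodic if `last` is never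
  -- met, and one minimal period is a forbidden cycle.
  have reach : ∀ z, ∃ i, f^[i] z = last := by
    intro z
    by_contra! hcon
    obtain ⟨i, j, hij, hfij⟩ : ∃ i j, i < j ∧ f^[i] z = f^[j] z := by
      obtain ⟨i, j, hne, h⟩ := Finite.exists_ne_map_eq_of_infinite (fun i : ℕ => f^[i] z)
      rcases lt_or_gt_of_ne hne with h' | h'
      · exact ⟨i, j, h', h⟩
      · exact ⟨j, i, h', h.symm⟩
    set y := f^[i] z with hy
    have hper : y ∈ Function.periodicPts f := by
      refine ⟨j - i, by omega, ?_⟩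
      rw [Function.IsPeriodicPt, Function.IsFixedPt, hy, ← Function.iterate_add_apply,
        Nat.sub_add_cancel hij.le, ← hfij]
    have hmp := Function.minimalPeriod_pos_of_mem_periodicPts hper
    have hm : ∃ m, Function.minimalPeriod f y = m + 1 := ⟨_, (Nat.succ_pred_eq_of_pos hmp).symm⟩
    obtain ⟨m, hm⟩ := hm
    have hne : ∀ k, f^[k] y ≠ last := fun k => by
      rw [hy, ← Function.iterate_add_apply]; exact hcon _
    have hinj : Function.Injective fun k : Fin (m + 1) => f^[k] y := by
      intro a b hab
      have := Function.iterate_injOn_Iio_minimalPeriod (f := f) (x := y)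
        (by rw [Set.mem_Iio, hm]; exact a.2) (by rw [Set.mem_Iio, hm]; exact b.2) hab
      exact Fin.ext this
    refine hf ⟨m, fun k => f^[k] y, fun k => (f^[k] y, f (f^[k] y)), hinj, ?_, ?_⟩
    · intro a b hab
      exact hinj (Prod.mk.inj hab).1
    · intro k
      refine ⟨hf' _ (hne k), Or.inl ?_⟩
      simp only [Prod.mk.injEq, true_and]
      rw [← Function.iterate_succ_apply' f, Fin.val_add_one]
      split_ifs with hk
      · have hk' : (k : ℕ) + 1 = Function.minimalPeriod f y := by rw [hk, hm]; rfl
        rw [Nat.succ_eq_add_one, hk', Function.iterate_minimalPeriod]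
        rfl
      · rfl
  have hS : ∀ z, S z ↔ S last := by
    intro z
    obtain ⟨i, hi⟩ := reach z
    induction i generalizing z with
    | zero => rw [← hi]; rfl
    | succ i ih =>
      by_cases hz : z = last
      · rw [hz]
      · rw [edge_iff_of_invariant ht hc (hf' z hz)]
        exact ih _ hi
  exact fun y z => (hS y).trans (hS z).symm

/-- Incoming edges are unique, so accessibility along edges is itself an edge-invariant predicate;
it holds at `v_1⁻¹`, which has no incoming edge, hence everywhere. A cycle therefore has a minimal
vertex. Both cycle edges at that vertex leave it, so they coincide by uniqueness of outgoing edges;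
the cycle is then a loop, which minimality excludes too. -/
theorem isForest_of_whiteheadConnected (hv : Set.BijOn v Set.univ (posLetters g p))
    (hc : WhiteheadConnected (List.ofFn v)) : IsForest (whiteheadEdges v) := by
  rintro ⟨n, u, e, hu, he, h⟩
  let R : Letter g p → Letter g p → Prop := fun y z => (y, z) ∈ whiteheadEdges v
  have hacc : ∀ y z, R y z → (Acc R y ↔ Acc R z) := by
    intro y z hyz
    constructor
    · intro hy
      exact Acc.intro _ fun y' hy' => whiteheadEdges_in_unique hv hyz hy' ▸ hy
    · intro hz
      exact hz.inv hyz
  have hall := hc (Acc R)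
    (by
      rintro z ⟨j, rfl⟩
      exact hacc _ _ (Or.inl ⟨j, rfl⟩))
    (isChain_ofFn_iff.2 fun k l hkl => hacc _ _ (Or.inr ⟨k, l, hkl, rfl⟩))
  have hpos : 0 < 4 * g + p := by
    obtain ⟨j | i | i, b⟩ := u 0
    · have := j.pos; omega
    · have := i.pos; omega
    · have := i.pos; omega
  have hfirst : Acc R (v ⟨0, hpos⟩).inv := by
    refine Acc.intro _ fun y hy => ?_
    rcases hy with ⟨j, hj⟩ | ⟨k, l, hkl, hj⟩
    · have hmem : v ⟨0, hpos⟩ ∈ posLetters g p := hv.mapsTo (Set.mem_univ _)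
      have := Letter.inv_notMem_of_mem_tLetters (g := g) (z := (Gen.t j, true)) ⟨j, rfl⟩
      rw [← (Prod.mk.inj hj).2, Letter.inv_inv] at this
      exact absurd hmem this
    · have := hv.injOn (Set.mem_univ _) (Set.mem_univ _) (Letter.inv_injective (Prod.mk.inj hj).2)
      rw [← this] at hkl
      simp at hkl
  have hwf : WellFounded R := ⟨fun z => (hall _ z).1 hfirst⟩
  obtain ⟨m, ⟨i, rfl⟩, hmin⟩ := hwf.has_min (Set.range u) ⟨_, 0, rfl⟩
  have h1 : e i = (u i, u (i + 1)) := by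
    rcases (h i).2 with h' | h'
    · exact h'
    · exact absurd (h' ▸ (h i).1) (hmin _ ⟨_, rfl⟩)
  have h2 : e (i - 1) = (u i, u (i - 1)) := by
    have := h (i - 1)
    rw [sub_add_cancel] at this
    rcases this.2 with h' | h'
    · exact absurd (h' ▸ this.1) (hmin _ ⟨_, rfl⟩)
    · exact h'
  have h3 : u (i + 1) = u (i - 1) :=
    whiteheadEdges_out_unique hv (h1 ▸ (h i).1) (h2 ▸ (h (i - 1)).1)
  have h4 : i = i - 1 := he (by rw [h1, h2, h3])
  have h5 : u (i + 1) = u i := by rw [h3, ← h4]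
  refine hmin (u i) ⟨_, rfl⟩ ?_
  have := (h i).1
  rw [h1, h5] at this
  exact this

theorem isZieschangSeq_iff {V : F g p} :
    IsZieschangSeq v V ↔ IsZieschangList (List.ofFn v) ∧ listElt (List.ofFn v) = V := by
  have hprod : listElt (List.ofFn v) = (List.ofFn fun k => (v k).elt).prod := by
    rw [listElt, List.map_ofFn]
    rfl
  rw [hprod]
  constructor
  · intro h
    refine ⟨⟨?_, ?_, by simp, whiteheadConnected_of_isForest h.bijOn h.forest⟩, h.prod_eq⟩
    · rw [List.nodup_ofFn]
      exact Set.injOn_univ.1 h.bijOn.injOn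
    · intro z
      rw [List.mem_ofFn', ← Set.image_univ, h.bijOn.image_eq]
  · rintro ⟨h, hV⟩
    have hbij : Set.BijOn v Set.univ (posLetters g p) := by
      refine ⟨fun k _ => (h.mem_iff _).1 (by simp), Set.injOn_univ.2 (List.nodup_ofFn.1 h.nodup),
        fun z hz => ?_⟩
      have := (h.mem_iff z).2 hz
      rw [List.mem_ofFn'] at this
      rwa [Set.image_univ]
    exact ⟨hbij, hV, isForest_of_whiteheadConnected hbij h.connected⟩

end Forest

theorem IsZieschangList.exists_seq {L : List (Letter g p)} (hL : IsZieschangList L) :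
    ∃ v, IsZieschangSeq v (listElt L) ∧ List.ofFn v = L := by
  obtain ⟨v, rfl⟩ : ∃ v : Fin (4 * g + p) → Letter g p, List.ofFn v = L := by
    rw [← hL.length_eq]
    exact ⟨L.get, List.ofFn_get L⟩
  exact ⟨v, isZieschangSeq_iff.2 ⟨hL, rfl⟩, rfl⟩

theorem isZieschang_iff {V : F g p} :
    IsZieschang V ↔ ∃ L : List (Letter g p), IsZieschangList L ∧ listElt L = V := by
  constructor
  · rintro ⟨v, hv⟩
    exact ⟨_, isZieschangSeq_iff.1 hv⟩
  · rintro ⟨L, hL, rfl⟩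
    obtain ⟨v, hv, -⟩ := hL.exists_seq
    exact ⟨v, hv⟩

/-! ### Rearrangements that preserve connectedness -/

section Connected

theorem edgeInvariant_chain_congr {S S' : Letter g p → Prop} {L : List (Letter g p)}
    (h : ∀ z ∈ L, (S z ↔ S' z) ∧ (S z.inv ↔ S' z.inv)) (hL : L.IsChain (EdgeInvariant S)) :
    L.IsChain (EdgeInvariant S') :=
  hL.imp_of_mem_imp fun a b ha hb hab => by
    rw [EdgeInvariant] at hab ⊢
    rw [← (h a ha).1, ← (h b hb).2, hab]

/-- Reversing the list inverts the vertices and the direction of all edges; the `t`-edges go to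
themselves. Left-handed statements follow from right-handed ones through this symmetry. -/
theorem whiteheadConnected_reverse {L : List (Letter g p)} (hL : WhiteheadConnected L) :
    WhiteheadConnected L.reverse := by
  intro S ht hc y z
  have := hL (fun z => S z.inv) (fun z hz => by rw [Letter.inv_inv]; exact (ht z hz).symm) ?_
    y.inv z.inv
  · simpa using this
  · rw [List.isChain_reverse] at hc
    refine hc.imp fun a b hab => ?_
    simp only [EdgeInvariant, Letter.inv_inv] at hab ⊢
    exact hab.symm

theorem IsZieschangList.reverse {L : List (Letter g p)} (hL : IsZieschangList L) :
    IsZieschangList L.reverse :=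
  ⟨List.nodup_reverse.2 hL.nodup, fun z => by rw [List.mem_reverse, hL.mem_iff],
    by rw [List.length_reverse, hL.length_eq], whiteheadConnected_reverse hL.connected⟩

theorem isZieschangList_of_reverse {L : List (Letter g p)} (hL : IsZieschangList L.reverse) :
    IsZieschangList L := by
  simpa using hL.reverse

theorem IsZieschangList.of_perm {L L' : List (Letter g p)} (hL : IsZieschangList L)
    (hp : L.Perm L') (hc : WhiteheadConnected L') : IsZieschangList L' :=
  ⟨hp.nodup_iff.1 hL.nodup, fun z => by rw [← hp.mem_iff, hL.mem_iff],
    by rw [← hp.length_eq, hL.length_eq], hc⟩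

theorem IsZieschangList.ne_inv_of_mem {L : List (Letter g p)} (hL : IsZieschangList L)
    {a z : Letter g p} (ha : a ∈ tLetters g p) (hz : z ∈ L) : z ≠ a.inv := by
  rintro rfl
  exact Letter.inv_notMem_of_mem_tLetters ha ((hL.mem_iff _).1 hz)

theorem isChain_append_cons {α : Type*} {r : α → α → Prop} {P Q : List α} {a : α} :
    (P ++ a :: Q).IsChain r ↔ (P.IsChain r ∧ ∀ x ∈ P.getLast?, r x a) ∧
      (∀ y ∈ Q.head?, r a y) ∧ Q.IsChain r := by
  rw [List.isChain_append, List.isChain_cons]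
  simp only [List.head?_cons, Option.mem_def, Option.some.injEq, forall_eq']
  tauto

/-- Exchanging a `t`-letter with its right neighbour. -/
theorem IsZieschangList.swap_of_left {P Q : List (Letter g p)} {a b : Letter g p}
    (hL : IsZieschangList (P ++ a :: b :: Q)) (ha : a ∈ tLetters g p) :
    IsZieschangList (P ++ b :: a :: Q) := by
  classical
  refine hL.of_perm (List.Perm.append_left P (List.Perm.swap _ _ _)) ?_
  have hnd := hL.nodup
  have hne : ∀ z ∈ P ++ a :: b :: Q, z ≠ a.inv := fun z hz => hL.ne_inv_of_mem ha hz
  intro S ht hc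
  obtain ⟨⟨hP, hPb⟩, hba, hQ⟩ := isChain_append_cons.1 hc
  obtain ⟨haQ, hQ⟩ := List.isChain_cons.1 hQ
  replace hba : S b ↔ S a.inv := hba a rfl
  -- The exchange takes the segment `a⁻¹ ⇝ a` of the path out of its place before `b⁻¹` and inserts
  -- it after `b`. Giving both vertices the value at `b⁻¹` turns an invariant of the new graph into
  -- one of the old.
  let S' : Letter g p → Prop := fun z => if z = a ∨ z = a.inv then S b.inv else S z
  have e1 : ∀ z, z ≠ a → z ≠ a.inv → (S z ↔ S' z) ∧ (S z.inv ↔ S' z.inv) := by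
    intro z h1 h2
    have h3 : z.inv ≠ a := fun h => h2 (Letter.inv_eq_iff.1 h)
    have h4 : z.inv ≠ a.inv := fun h => h1 (Letter.inv_injective h)
    simp [S', h1, h2, h3, h4]
  have e2 : S' a ↔ S b.inv := by simp [S']
  have e3 : S' a.inv ↔ S b.inv := by simp [S']
  have hnd' := List.nodup_middle.1 hnd
  rw [List.nodup_cons] at hnd'
  have hne' : ∀ z ∈ P ++ b :: Q, z ≠ a := fun z hz h => hnd'.1 (h ▸ hz)
  have e4 : ∀ z ∈ P ++ b :: Q, (S z ↔ S' z) ∧ (S z.inv ↔ S' z.inv) := fun z hz =>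
    e1 z (hne' z hz) (hne z (by grind))
  have eb := e4 b (by simp)
  have key := hL.connected S' ?_ ?_
  · have hSS : ∀ z, z ≠ a → z ≠ a.inv → (S z ↔ S b.inv) := fun z h1 h2 => by
      rw [(e1 z h1 h2).1, key z a, e2]
    have hSa : S a.inv ↔ S b.inv := by
      rw [← hba]
      exact hSS b (hne' b (by simp)) (hne b (by simp))
    have hall : ∀ z, S z ↔ S b.inv := by
      intro z
      by_cases h1 : z = a
      · rw [h1, ← ht a ha, hSa]
      · by_cases h2 : z = a.inv
        · rw [h2, hSa]
        · exact hSS z h1 h2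
    exact fun y z => (hall y).trans (hall z).symm
  · intro z hz
    by_cases h1 : z = a
    · rw [h1, e2, e3]
    · have h2 : z ≠ a.inv := by
        rintro rfl
        exact Letter.inv_notMem_of_mem_tLetters ha (Or.inl hz)
      rw [← (e1 z h1 h2).1, ← (e1 z h1 h2).2]
      exact ht z hz
  · rw [isChain_append_cons, List.isChain_cons]
    refine ⟨⟨edgeInvariant_chain_congr (fun z hz => e4 z (by simp [hz])) hP, ?_⟩, ?_, ?_,
      edgeInvariant_chain_congr (fun z hz => e4 z (by simp [hz])) hQ⟩
    · intro x hx
      rw [EdgeInvariant, e3, ← (e4 x (by simp [List.mem_of_mem_getLast? hx])).1]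
      exact hPb x hx
    · intro y hy
      obtain rfl : b = y := by simpa using hy
      rw [EdgeInvariant, e2, ← eb.2]
    · intro y hy
      have h1 : S a ↔ S y.inv := haQ y hy
      rw [EdgeInvariant, ← eb.1, ← (e4 y (by simp [List.mem_of_mem_head? hy])).2, ← h1, ← ht a ha]
      exact hba

/-- Exchanging a `t`-letter with its left neighbour. -/
theorem IsZieschangList.swap_of_right {P Q : List (Letter g p)} {a b : Letter g p}
    (hL : IsZieschangList (P ++ a :: b :: Q)) (hb : b ∈ tLetters g p) :
    IsZieschangList (P ++ b :: a :: Q) := by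
  refine isZieschangList_of_reverse ?_
  have := hL.reverse
  simp only [List.reverse_append, List.reverse_cons, List.append_assoc, List.cons_append,
    List.nil_append] at this ⊢
  exact this.swap_of_left hb

/-- Moving the right neighbour `b` of an `x`-letter `a` to the left of `a.inv`, when `a.inv` is
further right. -/
theorem IsZieschangList.move_right {P Q R : List (Letter g p)} {a b : Letter g p}
    (hL : IsZieschangList (P ++ a :: b :: (Q ++ a.inv :: R))) :
    IsZieschangList (P ++ a :: (Q ++ b :: a.inv :: R)) := by
  classical
  rcases Q with _ | ⟨q, Q⟩
  · simpa using hL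
  refine hL.of_perm ?_ ?_
  · refine (List.Perm.append_left P (List.Perm.cons a ?_))
    exact (List.perm_middle (l₁ := q :: Q) (l₂ := a.inv :: R) (a := b)).symm
  have h1 := hL.nodup
  have h2 := hL.nodup
  rw [List.nodup_middle, List.nodup_cons] at h1
  rw [show P ++ a :: b :: (q :: Q ++ a.inv :: R) = (P ++ a :: b :: q :: Q) ++ a.inv :: R by simp,
    List.nodup_middle, List.nodup_cons] at h2
  intro S ht hc
  rw [isChain_append_cons, isChain_append_cons] at hc
  obtain ⟨⟨hP, hPa⟩, haq, ⟨hQ, hQb⟩, hba, hR⟩ := hc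
  obtain ⟨hR, hR'⟩ := List.isChain_cons.1 hR
  replace haq : S a ↔ S q.inv := haq q (by simp)
  replace hba : S b ↔ S a := by simpa [EdgeInvariant] using hba
  -- Only the vertex `a` changes place in the path: in the old graph it precedes `b⁻¹`, in the new
  -- one it follows `b`. So `S` is altered at `a` alone.
  let S' : Letter g p → Prop := fun z => if z = a then S b.inv else S z
  have e1 : ∀ z, z ≠ a → (S z ↔ S' z) := fun z hz => by simp [S', hz]
  have e2 : S' a ↔ S b.inv := by simp [S']
  have ea : S a.inv ↔ S' a.inv := e1 _ (Letter.inv_ne a)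
  have e3 : ∀ z ∈ P ++ b :: q :: Q ++ R, (S z ↔ S' z) ∧ (S z.inv ↔ S' z.inv) := by
    intro z hz
    refine ⟨e1 _ fun h => h1.1 ?_, e1 _ fun h => h2.1 ?_⟩
    · rw [← h]
      grind
    · rw [Letter.inv_eq_iff.1 h] at hz
      grind
  have key := hL.connected S' ?_ ?_
  · have hSS : ∀ z, z ≠ a → (S z ↔ S b.inv) := fun z hz => by rw [e1 z hz, key z a, e2]
    have hall : ∀ z, S z ↔ S b.inv := by
      intro z
      by_cases hz : z = a
      · rw [hz, ← hba]
        exact hSS b fun h => h1.1 (by rw [h]; simp)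
      · exact hSS z hz
    exact fun y z => (hall y).trans (hall z).symm
  · intro z hz
    have hat : a.inv ∈ posLetters g p := (hL.mem_iff _).1 (by simp)
    have ha : a ∉ tLetters g p := fun h => Letter.inv_notMem_of_mem_tLetters h hat
    rw [← e1 z fun h => ha (h ▸ hz), ← e1 z.inv fun h => ?_]
    · exact ht z hz
    · rw [← h, Letter.inv_inv] at hat
      have ha' : a ∈ posLetters g p := (hL.mem_iff _).1 (by simp)
      exact Letter.inv_notMem_of_mem_tLetters hz (h ▸ ha')
  · refine isChain_append_cons.2 ⟨⟨edgeInvariant_chain_congr (fun z hz => e3 z (by simp [hz])) hP,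
      ?_⟩, ?_, List.isChain_cons.2 ⟨?_, isChain_append_cons.2 ⟨⟨edgeInvariant_chain_congr
      (fun z hz => e3 z (by grind)) hQ, ?_⟩,
      ?_, edgeInvariant_chain_congr (fun z hz => e3 z (by simp [hz])) hR'⟩⟩⟩
    · intro x hx
      rw [EdgeInvariant, ← ea, ← (e3 x (by simp [List.mem_of_mem_getLast? hx])).1]
      exact hPa x hx
    · intro y hy
      obtain rfl : b = y := by simpa using hy
      rw [EdgeInvariant, e2, ← (e3 b (by simp)).2]
    · intro y hy
      obtain rfl : q = y := by simpa using hy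
      rw [EdgeInvariant, ← (e3 b (by simp)).1, ← (e3 q (by simp)).2, ← haq, hba]
    · intro x hx
      have := List.mem_of_mem_getLast? hx
      rw [EdgeInvariant, Letter.inv_inv, e2, ← (e3 x (by grind)).1]
      exact hQb x hx
    · intro y hy
      rw [EdgeInvariant, ← ea, ← (e3 y (by simp [List.mem_of_mem_head? hy])).2]
      exact hR y hy

/-- Moving the right neighbour `b` of an `x`-letter `a` to the left of `a.inv`, when `a.inv` is
further left. -/
theorem IsZieschangList.move_left {P Q R : List (Letter g p)} {a b : Letter g p}
    (hL : IsZieschangList (P ++ a.inv :: (Q ++ a :: b :: R))) :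
    IsZieschangList (P ++ b :: a.inv :: (Q ++ a :: R)) := by
  classical
  refine hL.of_perm ?_ ?_
  · refine List.Perm.append_left P ?_
    simpa using List.perm_middle (l₁ := a.inv :: (Q ++ [a])) (l₂ := R) (a := b)
  have h1 := hL.nodup
  have h2 := hL.nodup
  rw [List.nodup_middle, List.nodup_cons] at h2
  rw [show P ++ a.inv :: (Q ++ a :: b :: R) = (P ++ a.inv :: Q) ++ a :: b :: R by simp,
    List.nodup_middle, List.nodup_cons] at h1
  intro S ht hc
  rw [isChain_append_cons, ← List.cons_append, isChain_append_cons] at hc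
  obtain ⟨⟨hP, hPb⟩, hba, ⟨hQ, hQa⟩, hR, hR'⟩ := hc
  replace hba : S b ↔ S a := by simpa [EdgeInvariant] using hba
  -- As for `move_right`: the vertex `a` leaves its place before `b⁻¹` and is inserted after `b`.
  let S' : Letter g p → Prop := fun z => if z = a then S b.inv else S z
  have e1 : ∀ z, z ≠ a → (S z ↔ S' z) := fun z hz => by simp [S', hz]
  have e2 : S' a ↔ S b.inv := by simp [S']
  have ea : S a.inv ↔ S' a.inv := e1 _ (Letter.inv_ne a)
  have e3 : ∀ z ∈ P ++ Q ++ b :: R, (S z ↔ S' z) ∧ (S z.inv ↔ S' z.inv) := by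
    intro z hz
    refine ⟨e1 _ fun h => h1.1 ?_, e1 _ fun h => h2.1 ?_⟩
    · rw [← h]
      grind
    · rw [Letter.inv_eq_iff.1 h] at hz
      grind
  have e4 : ∀ z ∈ a.inv :: Q, (S z ↔ S' z) := by
    intro z hz
    rcases List.mem_cons.1 hz with rfl | hz
    · exact ea
    · exact (e3 z (by simp [hz])).1
  have key := hL.connected S' ?_ ?_
  · have hSS : ∀ z, z ≠ a → (S z ↔ S b.inv) := fun z hz => by rw [e1 z hz, key z a, e2]
    have hall : ∀ z, S z ↔ S b.inv := by
      intro z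
      by_cases hz : z = a
      · rw [hz, ← hba]
        exact hSS b fun h => h1.1 (by rw [h]; simp)
      · exact hSS z hz
    exact fun y z => (hall y).trans (hall z).symm
  · intro z hz
    have hat : a.inv ∈ posLetters g p := (hL.mem_iff _).1 (by simp)
    have ha : a ∉ tLetters g p := fun h => Letter.inv_notMem_of_mem_tLetters h hat
    rw [← e1 z fun h => ha (h ▸ hz), ← e1 z.inv fun h => ?_]
    · exact ht z hz
    · have ha' : a ∈ posLetters g p := (hL.mem_iff _).1 (by simp)
      exact Letter.inv_notMem_of_mem_tLetters hz (h ▸ ha')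
  · rw [List.isChain_append, ← List.cons_append, isChain_append_cons]
    refine ⟨edgeInvariant_chain_congr (fun z hz => e3 z (by simp [hz])) hP,
      ⟨⟨?_, ?_⟩, ?_, List.isChain_cons.2
        ⟨?_, edgeInvariant_chain_congr (fun z hz => e3 z (by simp [hz])) hR'⟩⟩, ?_⟩
    · refine hQ.imp_of_mem_tail_imp fun x y hx hy hxy => ?_
      rw [EdgeInvariant] at hxy ⊢
      rw [← e4 x hx, ← (e3 y (by simp [List.tail_cons ▸ hy])).2, hxy]
    · intro x hx
      rw [EdgeInvariant, ← e4 x (List.mem_of_mem_getLast? hx), ← ea]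
      exact hQa x hx
    · intro y hy
      obtain rfl : b = y := by simpa using hy
      rw [EdgeInvariant, e2, ← (e3 b (by simp)).2]
    · intro y hy
      have h3 : S a ↔ S y.inv := hR y hy
      rw [EdgeInvariant, ← (e3 b (by simp)).1, ← (e3 y (by simp [List.mem_of_mem_head? hy])).2,
        hba, h3]
    · intro x hx y hy
      obtain rfl : a.inv = y := by simpa using hy
      rw [EdgeInvariant, Letter.inv_inv, e2, ← (e3 x (by simp [List.mem_of_mem_getLast? hx])).1]
      exact hPb x hx

end Connected

/-! ### Automorphisms that change a single letter -/

section Twist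

theorem Letter.fst_ne_of_ne {y z : Letter g p} (h : y ≠ z) (h' : y ≠ z.inv) : y.1 ≠ z.1 := by
  intro h1
  by_cases h2 : y.2 = z.2
  · exact h (Prod.ext h1 h2)
  · exact h' (Prod.ext h1 (by simpa [Letter.inv] using Bool.eq_not_of_ne h2))

/-- The endomorphism that sends the letter `a` to `c * a * d` and fixes the other generators. -/
def twistHom (a : Letter g p) (c d : F g p) : F g p →* F g p :=
  FreeGroup.lift fun y => if y = a.1 then
    (if a.2 then c * FreeGroup.of y * d else (c * (FreeGroup.of y)⁻¹ * d)⁻¹) else FreeGroup.of y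

theorem Letter.elt_true (y : Gen g p) : Letter.elt (y, true) = FreeGroup.of y := rfl

theorem Letter.elt_false (y : Gen g p) : Letter.elt (y, false) = (FreeGroup.of y)⁻¹ := rfl

theorem twistHom_self (a : Letter g p) (c d : F g p) :
    twistHom a c d a.elt = c * a.elt * d := by
  obtain ⟨y, _ | _⟩ := a
  · rw [Letter.elt_false, map_inv]
    simp [twistHom]
  · rw [Letter.elt_true]
    simp [twistHom]

theorem twistHom_of_ne {a z : Letter g p} (c d : F g p) (h : z.1 ≠ a.1) :
    twistHom a c d z.elt = z.elt := by
  obtain ⟨y, _ | _⟩ := z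
  · rw [Letter.elt_false, map_inv]
    simpa [twistHom] using fun h' => absurd h' h
  · rw [Letter.elt_true]
    simpa [twistHom] using fun h' => absurd h' h

theorem hom_ext_of_letter {G : Type*} [Group G] {f f' : F g p →* G} (a : Letter g p)
    (ha : f a.elt = f' a.elt) (h : ∀ z : Letter g p, z.1 ≠ a.1 → f z.elt = f' z.elt) : f = f' := by
  refine FreeGroup.ext_hom _ _ fun y => ?_
  by_cases hy : y = a.1
  · subst hy
    obtain ⟨y, _ | _⟩ := a
    · rw [Letter.elt_false, map_inv, map_inv, inv_inj] at ha
      exact ha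
    · exact ha
  · exact h (y, true) hy

/-- Elements that do not involve the generator underlying the letter `a`. -/
def FixedByTwists (a : Letter g p) (c : F g p) : Prop :=
  ∀ c' d' : F g p, twistHom a c' d' c = c

theorem FixedByTwists.inv {a : Letter g p} {c : F g p} (hc : FixedByTwists a c) :
    FixedByTwists a c⁻¹ := fun c' d' => by rw [map_inv, hc]

theorem fixedByTwists_one (a : Letter g p) : FixedByTwists a 1 := fun _ _ => map_one _

theorem fixedByTwists_elt {a b : Letter g p} (h : b.1 ≠ a.1) : FixedByTwists a b.elt :=
  fun c' d' => twistHom_of_ne c' d' h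

theorem twistHom_listElt {a : Letter g p} {L : List (Letter g p)} (c d : F g p)
    (h : ∀ z ∈ L, z.1 ≠ a.1) : twistHom a c d (listElt L) = listElt L := by
  rw [listElt, map_list_prod, List.map_map]
  congr 1
  exact List.map_congr_left fun z hz => twistHom_of_ne c d (h z hz)

theorem twistHom_comp_inv {a : Letter g p} {c d : F g p} (hc : FixedByTwists a c)
    (hd : FixedByTwists a d) :
    (twistHom a c⁻¹ d⁻¹).comp (twistHom a c d) = MonoidHom.id _ := by
  refine hom_ext_of_letter a ?_ fun z hz => ?_
  · rw [MonoidHom.comp_apply, twistHom_self, map_mul, map_mul, hc, hd, twistHom_self]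
    simp [mul_assoc]
  · rw [MonoidHom.comp_apply, twistHom_of_ne _ _ hz, twistHom_of_ne _ _ hz]
    rfl

/-- The automorphism that sends the letter `a` to `c * a * d` and fixes the other generators. -/
def twist (a : Letter g p) {c d : F g p} (hc : FixedByTwists a c) (hd : FixedByTwists a d) :
    MulAut (F g p) :=
  MonoidHom.toMulEquiv (twistHom a c d) (twistHom a c⁻¹ d⁻¹) (twistHom_comp_inv hc hd)
    (by simpa using twistHom_comp_inv hc.inv hd.inv)

theorem twist_apply {a : Letter g p} {c d : F g p} (hc : FixedByTwists a c)
    (hd : FixedByTwists a d) (u : F g p) : twist a hc hd u = twistHom a c d u := rfl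

theorem twist_symm_apply {a : Letter g p} {c d : F g p} (hc : FixedByTwists a c)
    (hd : FixedByTwists a d) (u : F g p) :
    (MulEquiv.symm (twist a hc hd)) u = twistHom a c⁻¹ d⁻¹ u := rfl

theorem fixesOthers_twist {a : Letter g p} {c d : F g p} (hc : FixedByTwists a c)
    (hd : FixedByTwists a d) : FixesOthers (twist a hc hd) a :=
  fun _ h h' => twistHom_of_ne c d (Letter.fst_ne_of_ne h h')

end Twist

/-! ### Nielsen edges of the second and third kind -/

section Moves

theorem listElt_append (L L' : List (Letter g p)) :
    listElt (L ++ L') = listElt L * listElt L' := by simp [listElt]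

theorem listElt_cons (a : Letter g p) (L : List (Letter g p)) :
    listElt (a :: L) = a.elt * listElt L := by simp [listElt]

/-- `ψ` is a Nielsen edge of the second or third kind that carries the list `L` to the list `L'`
and whose inverse changes only the letter `a`. -/
structure IsElementaryMove (L L' : List (Letter g p)) (a : Letter g p) (ψ : MulAut (F g p)) :
    Prop where
  isZieschangList : IsZieschangList L'
  map_listElt : ψ (listElt L) = listElt L'
  nielsen : IsN2 (listElt L) ψ ∨ IsN3 (listElt L) ψ
  fixes : ∀ z : Letter g p, z.1 ≠ a.1 → (MulEquiv.symm ψ) z.elt = z.elt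
  conj : ∀ j : Fin p, IsConj (ψ (FreeGroup.of (Gen.t j))) (FreeGroup.of (Gen.t j))

theorem exists_seq_of_append {P Q : List (Letter g p)} {a b : Letter g p}
    (hL : IsZieschangList (P ++ a :: b :: Q)) :
    ∃ v, IsZieschangSeq v (listElt (P ++ a :: b :: Q)) ∧
      ∃ k l : Fin (4 * g + p), (l : ℕ) = k + 1 ∧ v k = a ∧ v l = b := by
  obtain ⟨v, hv, hv'⟩ := hL.exists_seq
  have hlen : (P ++ a :: b :: Q).length = 4 * g + p := hL.length_eq
  have h1 : P.length + 1 < 4 * g + p := by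
    rw [← hlen]; simp
  refine ⟨v, hv, ⟨P.length, by omega⟩, ⟨P.length + 1, h1⟩, rfl, ?_, ?_⟩
  · have : (List.ofFn v)[P.length]? = some a := by rw [hv']; simp
    rw [List.getElem?_eq_getElem (by simp; omega), List.getElem_ofFn] at this
    simpa using this
  · have : (List.ofFn v)[P.length + 1]? = some b := by rw [hv']; simp
    rw [List.getElem?_eq_getElem (by simp; omega), List.getElem_ofFn] at this
    simpa using this

/-- Without this, the neighbour used in a twist could involve the twisted generator, and the twist
need not be invertible. -/
theorem IsZieschangList.ne_of_adjacent {P Q : List (Letter g p)} {a b : Letter g p}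
    (hL : IsZieschangList (P ++ a :: b :: Q)) : b.1 ≠ a.1 := by
  refine Letter.fst_ne_of_ne ?_ ?_
  · rintro rfl
    have := hL.nodup
    simp [List.nodup_append] at this
  · intro h
    have ha : a ∈ xLetters g p := by
      rcases (hL.mem_iff a).1 (by simp) with h' | h'
      · exact absurd h (hL.ne_inv_of_mem h' (by simp))
      · exact h'
    -- the Whitehead graph has a loop at `a`
    have := hL.connected (fun z => z = a) ?_ ?_ a a.inv
    · exact Letter.inv_ne a (this.1 rfl)
    · intro z hz
      have h1 : z ≠ a := fun h => Letter.notMem_tLetters_of_mem_xLetters ha (h ▸ hz)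
      have h2 : z.inv ≠ a := fun h => Letter.notMem_tLetters_of_mem_xLetters
        (Letter.inv_mem_xLetters ha) (h ▸ by rwa [Letter.inv_inv])
      simp [h1, h2]
    · have hnd := hL.nodup
      subst h
      have h1 := (List.nodup_cons.1 (List.nodup_middle.1 hnd)).1
      have h2 : a.inv ∉ (P ++ [a]) ++ Q ∧ _ := List.nodup_cons.1
        (List.nodup_middle.1 (by simpa using hnd : ((P ++ [a]) ++ a.inv :: Q).Nodup))
      have hS : ∀ z ∈ P ++ Q, z ≠ a ∧ z.inv ≠ a := fun z hz =>
        ⟨fun h => h1 (by grind), fun h => h2.1 (by rw [Letter.inv_eq_iff] at h; grind)⟩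
      have hc : ∀ M : List (Letter g p), (∀ z ∈ M, z ∈ P ++ Q) →
          M.IsChain (EdgeInvariant fun z => z = a) := fun M hM =>
        edgeInvariant_chain_congr (S := fun _ => False) (fun z hz => by simp [hS z (hM z hz)])
          (List.isChain_iff_getElem.2 fun _ _ => Iff.rfl)
      refine isChain_append_cons.2 ⟨⟨hc P fun z hz => by simp [hz], fun x hx => ?_⟩, ?_,
        List.isChain_cons.2 ⟨fun y hy => ?_, hc Q fun z hz => by simp [hz]⟩⟩
      · simp [EdgeInvariant, hS x (by simp [List.mem_of_mem_getLast? hx]), Letter.inv_ne a]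
      · intro y hy
        obtain rfl : a.inv = y := by simpa using hy
        simp [EdgeInvariant]
      · simp [EdgeInvariant, hS y (by simp [List.mem_of_mem_head? hy]), Letter.inv_ne a]

theorem isConj_twist_of_mem_xLetters {a : Letter g p} (ha : a ∈ xLetters g p) {c d : F g p}
    (hc : FixedByTwists a c) (hd : FixedByTwists a d) (j : Fin p) :
    IsConj (twist a hc hd (FreeGroup.of (Gen.t j))) (FreeGroup.of (Gen.t j)) := by
  have : ((Gen.t j, true) : Letter g p).1 ≠ a.1 := by
    obtain ⟨i, b, rfl | rfl⟩ := ha <;> simp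
  rw [twist_apply, ← Letter.elt_true, twistHom_of_ne _ _ this]

theorem isConj_twist_conj {a : Letter g p} (ha : a ∈ tLetters g p) {c d : F g p}
    (hc : FixedByTwists a c) (hd : FixedByTwists a d) (hcd : c * d = 1) (j : Fin p) :
    IsConj (twist a hc hd (FreeGroup.of (Gen.t j))) (FreeGroup.of (Gen.t j)) := by
  rw [twist_apply, ← Letter.elt_true]
  by_cases h : ((Gen.t j, true) : Letter g p).1 = a.1
  · obtain ⟨i, rfl⟩ := ha
    obtain rfl : j = i := by simpa using h
    rw [twistHom_self, eq_inv_of_mul_eq_one_right hcd]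
    exact (isConj_iff.2 ⟨c, rfl⟩).symm
  · rw [twistHom_of_ne _ _ h]

/-- Multiplying an `x`-letter on the right. -/
theorem exists_move_mul_right {P Q : List (Letter g p)} {a b : Letter g p}
    (hL : IsZieschangList (P ++ a :: b :: Q)) (ha : a ∈ xLetters g p) :
    ∃ L' ψ, IsElementaryMove (P ++ a :: b :: Q) L' a ψ ∧
      (MulEquiv.symm ψ) a.elt = a.elt * b.elt := by
  have hba := hL.ne_of_adjacent
  have hb : FixedByTwists a b.elt := fixedByTwists_elt hba
  obtain ⟨v, hv, k, l, hkl, hk, hl⟩ := exists_seq_of_append hL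
  have hself := twistHom_self a 1 b.elt⁻¹
  rw [one_mul] at hself
  -- Under `a ↦ a * b⁻¹` the letter `b` vanishes behind `a` and reappears in front of `a⁻¹`; this is
  -- the rearrangement of `move_left` or `move_right`, according to the side on which `a⁻¹` stands.
  have hinv : twistHom a 1 b.elt⁻¹ a.inv.elt = b.elt * a.inv.elt := by
    rw [Letter.elt_inv, map_inv, hself, mul_inv_rev, inv_inv]
  have main : ∀ L', IsZieschangList L' →
      twistHom a 1 b.elt⁻¹ (listElt (P ++ a :: b :: Q)) = listElt L' →
      ∃ L' ψ, IsElementaryMove (P ++ a :: b :: Q) L' a ψ ∧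
      (MulEquiv.symm ψ) a.elt = a.elt * b.elt := by
    intro L' hL' h
    refine ⟨L', twist a (fixedByTwists_one a) hb.inv, ⟨hL', h, Or.inl ?_, fun z hz => ?_,
      isConj_twist_of_mem_xLetters ha _ _⟩, ?_⟩
    · refine ⟨v, hv, k, l, hk ▸ ha, by rw [hk]; exact fixesOthers_twist _ _, Or.inl ⟨hkl, ?_⟩⟩
      rw [hk, hl]
      exact hself
    · exact twistHom_of_ne _ _ hz
    · rw [twist_symm_apply, twistHom_self]
      simp
  have hmem : a.inv ∈ P ++ a :: b :: Q :=
    (hL.mem_iff _).2 (Or.inr (Letter.inv_mem_xLetters ha))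
  have hnd := hL.nodup
  have h1 := List.nodup_cons.1 (List.nodup_middle.1 hnd)
  have hib : a.inv ≠ b := fun h => hba (by rw [← h]; rfl)
  have hmem' : a.inv ∈ P ∨ a.inv ∈ Q := by
    have := Letter.inv_ne a
    simp only [List.mem_append, List.mem_cons] at hmem
    tauto
  have hfix : ∀ M : List (Letter g p), (∀ z ∈ M, z ≠ a ∧ z ≠ a.inv) →
      twistHom a 1 b.elt⁻¹ (listElt M) = listElt M := fun M hM =>
    twistHom_listElt _ _ fun z hz => Letter.fst_ne_of_ne (hM z hz).1 (hM z hz).2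
  rcases hmem' with h | h
  · obtain ⟨P, P', rfl⟩ := List.append_of_mem h
    have h2 := hL
    simp only [List.append_assoc, List.cons_append] at h2 hnd
    have h3 := List.nodup_cons.1 (List.nodup_middle.1 hnd)
    refine main _ h2.move_left ?_
    simp only [listElt_append, listElt_cons, map_mul, List.append_assoc, List.cons_append]
    rw [hinv, hself, hb, hfix P (by grind), hfix P' (by grind), hfix Q (by grind)]
    simp [mul_assoc]
  · obtain ⟨Q, Q', rfl⟩ := List.append_of_mem h
    have h3 := List.nodup_cons.1 (List.nodup_middle.1
      (by simpa using hnd : ((P ++ a :: b :: Q) ++ a.inv :: Q').Nodup))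
    refine main _ hL.move_right ?_
    simp only [listElt_append, listElt_cons, map_mul]
    rw [hinv, hself, hb, hfix P (by grind), hfix Q (by grind), hfix Q' (by grind)]
    simp [mul_assoc]

/-- Multiplying an `x`-letter on the left. -/
theorem exists_move_mul_left {P Q : List (Letter g p)} {a b : Letter g p}
    (hL : IsZieschangList (P ++ a :: b :: Q)) (hb : b ∈ xLetters g p) :
    ∃ L' ψ, IsElementaryMove (P ++ a :: b :: Q) L' b ψ ∧
      (MulEquiv.symm ψ) b.elt = a.elt * b.elt := by
  have hba := hL.ne_of_adjacent
  have ha : FixedByTwists b a.elt := fixedByTwists_elt hba.symm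
  obtain ⟨v, hv, k, l, hkl, hk, hl⟩ := exists_seq_of_append hL
  have hself := twistHom_self b a.elt⁻¹ 1
  rw [mul_one] at hself
  have hinv : twistHom b a.elt⁻¹ 1 b.inv.elt = b.inv.elt * a.elt := by
    rw [Letter.elt_inv, map_inv, hself, mul_inv_rev, inv_inv]
  have main : ∀ L', IsZieschangList L' →
      twistHom b a.elt⁻¹ 1 (listElt (P ++ a :: b :: Q)) = listElt L' →
      ∃ L' ψ, IsElementaryMove (P ++ a :: b :: Q) L' b ψ ∧
      (MulEquiv.symm ψ) b.elt = a.elt * b.elt := by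
    intro L' hL' h
    refine ⟨L', twist b ha.inv (fixedByTwists_one b), ⟨hL', h, Or.inl ?_, fun z hz => ?_,
      isConj_twist_of_mem_xLetters hb _ _⟩, ?_⟩
    · refine ⟨v, hv, l, k, hl ▸ hb, by rw [hl]; exact fixesOthers_twist _ _, Or.inr ⟨hkl.symm, ?_⟩⟩
      rw [hk, hl]
      exact hself
    · exact twistHom_of_ne _ _ hz
    · rw [twist_symm_apply, twistHom_self]
      simp
  have hmem : b.inv ∈ P ++ a :: b :: Q :=
    (hL.mem_iff _).2 (Or.inr (Letter.inv_mem_xLetters hb))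
  have hnd := hL.nodup
  have h1 := List.nodup_cons.1 (List.nodup_middle.1
      (by simpa using hnd : ((P ++ [a]) ++ b :: Q).Nodup))
  have hia : b.inv ≠ a := fun h => hba (by rw [← h]; rfl)
  have hmem' : b.inv ∈ P ∨ b.inv ∈ Q := by
    have := Letter.inv_ne b
    simp only [List.mem_append, List.mem_cons] at hmem
    tauto
  have hfix : ∀ M : List (Letter g p), (∀ z ∈ M, z ≠ b ∧ z ≠ b.inv) →
      twistHom b a.elt⁻¹ 1 (listElt M) = listElt M := fun M hM =>
    twistHom_listElt _ _ fun z hz => Letter.fst_ne_of_ne (hM z hz).1 (hM z hz).2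
  -- In the reversed list `a` is the right neighbour of `b`, so the rearrangements already proved
  -- apply.
  have hrev := hL.reverse
  rcases hmem' with h | h
  · obtain ⟨P, P', rfl⟩ := List.append_of_mem h
    simp only [List.reverse_append, List.reverse_cons, List.append_assoc, List.cons_append,
      List.nil_append] at hrev
    simp only [List.append_assoc, List.cons_append] at hnd
    have h3 := List.nodup_cons.1 (List.nodup_middle.1 hnd)
    refine main (P ++ b.inv :: a :: (P' ++ b :: Q)) (isZieschangList_of_reverse ?_) ?_
    · simpa using hrev.move_right
    · simp only [listElt_append, listElt_cons, map_mul, List.append_assoc, List.cons_append]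
      rw [hinv, hself, ha, hfix P (by grind), hfix P' (by grind), hfix Q (by grind)]
      simp [mul_assoc]
  · obtain ⟨Q, Q', rfl⟩ := List.append_of_mem h
    simp only [List.reverse_append, List.reverse_cons, List.append_assoc, List.cons_append,
      List.nil_append] at hrev
    have h3 := List.nodup_cons.1 (List.nodup_middle.1
      (by simpa using hnd : ((P ++ a :: b :: Q) ++ b.inv :: Q').Nodup))
    refine main (P ++ b :: (Q ++ b.inv :: a :: Q')) (isZieschangList_of_reverse ?_) ?_
    · simpa using hrev.move_left
    · simp only [listElt_append, listElt_cons, map_mul]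
      rw [hinv, hself, ha, hfix P (by grind), hfix Q (by grind), hfix Q' (by grind)]
      simp [mul_assoc]

/-- Conjugating a `t`-letter by its right neighbour. -/
theorem exists_move_conj_right {P Q : List (Letter g p)} {a b : Letter g p}
    (hL : IsZieschangList (P ++ a :: b :: Q)) (ha : a ∈ tLetters g p) :
    ∃ L' ψ, IsElementaryMove (P ++ a :: b :: Q) L' a ψ ∧
      (MulEquiv.symm ψ) a.elt = b.elt⁻¹ * a.elt * b.elt := by
  have hba := hL.ne_of_adjacent
  have hb : FixedByTwists a b.elt := fixedByTwists_elt hba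
  obtain ⟨v, hv, k, l, hkl, hk, hl⟩ := exists_seq_of_append hL
  have hself := twistHom_self a b.elt b.elt⁻¹
  have h1 := List.nodup_cons.1 (List.nodup_middle.1 hL.nodup)
  have hne : ∀ z ∈ P ++ a :: b :: Q, z ≠ a.inv := fun z hz => hL.ne_inv_of_mem ha hz
  have hfix : ∀ M : List (Letter g p), (∀ z ∈ M, z ≠ a ∧ z ≠ a.inv) →
      twistHom a b.elt b.elt⁻¹ (listElt M) = listElt M := fun M hM =>
    twistHom_listElt _ _ fun z hz => Letter.fst_ne_of_ne (hM z hz).1 (hM z hz).2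
  refine ⟨P ++ b :: a :: Q, twist a hb hb.inv, ⟨hL.swap_of_left ha, ?_, Or.inr ?_, fun z hz => ?_,
      isConj_twist_conj ha _ _ (mul_inv_cancel _)⟩, ?_⟩
  · simp only [twist_apply, listElt_append, listElt_cons, map_mul]
    rw [hself, hb, hfix P (by grind), hfix Q (by grind)]
    simp [mul_assoc]
  · refine ⟨v, hv, k, l, hk ▸ ha, by rw [hk]; exact fixesOthers_twist _ _, Or.inl ⟨hkl, ?_⟩⟩
    rw [hk, hl]
    exact hself
  · exact twistHom_of_ne _ _ hz
  · rw [twist_symm_apply, twistHom_self, inv_inv]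

/-- Conjugating a `t`-letter by its left neighbour. -/
theorem exists_move_conj_left {P Q : List (Letter g p)} {a b : Letter g p}
    (hL : IsZieschangList (P ++ a :: b :: Q)) (hb : b ∈ tLetters g p) :
    ∃ L' ψ, IsElementaryMove (P ++ a :: b :: Q) L' b ψ ∧
      (MulEquiv.symm ψ) b.elt = a.elt * b.elt * a.elt⁻¹ := by
  have hba := hL.ne_of_adjacent
  have ha : FixedByTwists b a.elt := fixedByTwists_elt hba.symm
  obtain ⟨v, hv, k, l, hkl, hk, hl⟩ := exists_seq_of_append hL
  have hself := twistHom_self b a.elt⁻¹ a.elt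
  have h1 := List.nodup_cons.1 (List.nodup_middle.1
      (by simpa using hL.nodup : ((P ++ [a]) ++ b :: Q).Nodup))
  have hne : ∀ z ∈ P ++ a :: b :: Q, z ≠ b.inv := fun z hz => hL.ne_inv_of_mem hb hz
  have hfix : ∀ M : List (Letter g p), (∀ z ∈ M, z ≠ b ∧ z ≠ b.inv) →
      twistHom b a.elt⁻¹ a.elt (listElt M) = listElt M := fun M hM =>
    twistHom_listElt _ _ fun z hz => Letter.fst_ne_of_ne (hM z hz).1 (hM z hz).2
  refine ⟨P ++ b :: a :: Q, twist b ha.inv ha, ⟨hL.swap_of_right hb, ?_, Or.inr ?_,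
      fun z hz => ?_, isConj_twist_conj hb _ _ (inv_mul_cancel _)⟩, ?_⟩
  · simp only [twist_apply, listElt_append, listElt_cons, map_mul]
    rw [hself, ha, hfix P (by grind), hfix Q (by grind)]
    simp [mul_assoc]
  · refine ⟨v, hv, l, k, hl ▸ hb, by rw [hl]; exact fixesOthers_twist _ _, Or.inr ⟨hkl.symm, ?_⟩⟩
    rw [hk, hl]
    exact hself
  · exact twistHom_of_ne _ _ hz
  · rw [twist_symm_apply, twistHom_self, inv_inv]

end Moves

open FreeGroup

universe u

/-! ### Cancellation between neighbours and the order on words -/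

section Words

variable {X : Type*}

theorem isReduced_append_of_isReduced {A B : List (X × Bool)} (hA : IsReduced A)
    (hB : IsReduced B) (h : ∀ x ∈ A.getLast?, ∀ y ∈ B.head?, x.1 = y.1 → x.2 = y.2) :
    IsReduced (A ++ B) :=
  List.isChain_append.2 ⟨hA, hB, h⟩

theorem exists_cancellation_of_isReduced (A : List (X × Bool)) :
    ∀ B : List (X × Bool), IsReduced A → IsReduced B →
      ∃ p c q, A = p ++ c ∧ B = invRev c ++ q ∧ IsReduced (p ++ q) := by
  classical
  induction A using List.reverseRecOn with
  | nil => exact fun B _ hB => ⟨[], [], B, rfl, rfl, hB⟩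
  | append_singleton A x ih =>
    intro B hA hB
    by_cases h : ∃ B', B = (x.1, !x.2) :: B'
    · obtain ⟨B, rfl⟩ := h
      obtain ⟨p, c, q, rfl, rfl, hpq⟩ := ih B (hA.infix (List.prefix_append _ _).isInfix)
        (hB.infix (List.suffix_cons _ _).isInfix)
      exact ⟨p, c ++ [x], q, by simp, by simp [invRev], hpq⟩
    · refine ⟨A ++ [x], [], B, by simp, by simp, isReduced_append_of_isReduced hA hB ?_⟩
      intro a ha b hb hab
      obtain rfl : x = a := by simpa using ha
      by_contra hne
      cases B with
      | nil => simp at hb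
      | cons y B =>
        obtain rfl : y = b := by simpa using hb
        refine h ⟨B, ?_⟩
        congr 1
        refine Prod.ext hab.symm ?_
        simpa using Bool.eq_not_of_ne (Ne.symm hne)

/-- The last half of a word, read backwards. -/
def half (w : List (X × Bool)) : List (X × Bool) := w.reverse.take (w.length / 2)

/-- A suffix of at most half the word opens its `half`, so it is what the lexicographic comparison
sees first. -/
theorem half_append {p c : List (X × Bool)} (h : c.length ≤ p.length) :
    half (p ++ c) = c.reverse ++ p.reverse.take ((p ++ c).length / 2 - c.length) := by
  rw [half, List.reverse_append, List.take_append, List.length_reverse, List.take_of_length_le]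
  simp
  omega

/-- The first half of `p ++ c` lies inside `p`, so exchanging `c` for a word of equal length does
not affect the rank of the inverse. -/
theorem half_invRev_append {p c : List (X × Bool)} (h : c.length ≤ p.length) :
    half (invRev (p ++ c)) = (invRev p).reverse.take ((p.length + c.length) / 2) := by
  rw [half, invRev_length, invRev_append, List.reverse_append, List.take_append_of_le_length]
  · simp
  · simp; omega

theorem invRev_conj (u : List (X × Bool)) (t : X × Bool) :
    invRev (invRev u ++ [t] ++ u) = invRev u ++ [(t.1, !t.2)] ++ u := by
  simp only [invRev_append, invRev_invRev, List.append_assoc]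
  rfl

theorem half_conj (u : List (X × Bool)) (t : X × Bool) :
    half (invRev u ++ [t] ++ u) = u.reverse := by
  rw [half_append (by simp)]
  have : (invRev u ++ [t] ++ u).length / 2 - u.length = 0 := by simp; omega
  rw [this]
  simp

variable [DecidableEq X]

/-- `g = p * c` and `h = c⁻¹ * q` are reduced, and `c` is what cancels in `g * h`. -/
structure Cancels (g h : FreeGroup X) (p c q : List (X × Bool)) : Prop where
  left : g.toWord = p ++ c
  right : h.toWord = invRev c ++ q
  mul : (g * h).toWord = p ++ q

theorem exists_cancels (g h : FreeGroup X) : ∃ p c q, Cancels g h p c q := by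
  obtain ⟨p, c, q, h1, h2, h3⟩ := exists_cancellation_of_isReduced g.toWord h.toWord
    isReduced_toWord isReduced_toWord
  refine ⟨p, c, q, h1, h2, ?_⟩
  have : g * h = FreeGroup.mk (p ++ q) := by
    rw [← mk_toWord (x := g), ← mk_toWord (x := h), h1, h2, ← mul_mk, ← mul_mk, ← mul_mk,
      ← inv_mk]
    group
  rw [this, toWord_mk, h3.reduce_eq]

theorem Cancels.symm {g h : FreeGroup X} {p c q : List (X × Bool)} (H : Cancels g h p c q) :
    Cancels h⁻¹ g⁻¹ (invRev q) c (invRev p) := by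
  refine ⟨?_, ?_, ?_⟩
  · rw [toWord_inv, H.right, invRev_append, invRev_invRev]
  · rw [toWord_inv, H.left, invRev_append]
  · rw [← mul_inv_rev, toWord_inv, H.mul, invRev_append]

theorem toWord_mk_eq_or_norm_lt (L : List (X × Bool)) :
    (FreeGroup.mk L).toWord = L ∨ norm (FreeGroup.mk L) < L.length := by
  rcases (norm_mk_le (L₁ := L)).lt_or_eq with h | h
  · exact Or.inr h
  · left
    have hsub := (reduce.red (L := L)).sublist
    rw [toWord_mk]
    refine hsub.eq_of_length ?_
    rw [← toWord_mk]
    exact h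

/-- Compares the length of words first, then their last halves. -/
def wordRel (X : Type*) : ℕ × List (X × Bool) → ℕ × List (X × Bool) → Prop :=
  Prod.Lex (· < ·) (List.Shortlex WellOrderingRel)

instance (X : Type*) : IsWellFounded _ (wordRel X) :=
  ⟨WellFounded.prod_lex wellFounded_lt (List.Shortlex.wf WellOrderingRel.isWellOrder.wf)⟩

/-- An ordinal that grows with the length of an element, and then with the last half of its
reduced word. -/
noncomputable def wordRank {X : Type u} [DecidableEq X] (g : FreeGroup X) : Ordinal.{u} :=
  IsWellFounded.rank (wordRel X) (norm g, half g.toWord)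

theorem wordRank_lt_of_norm_lt {g h : FreeGroup X} (H : norm g < norm h) :
    wordRank g < wordRank h :=
  IsWellFounded.rank_lt_of_rel (Prod.Lex.left _ _ H)

theorem lex_append_of_length_eq {α : Type*} {r : α → α → Prop} {s s' : List α} (t t' : List α)
    (h : List.Lex r s s') (hl : s.length = s'.length) : List.Lex r (s ++ t) (s' ++ t') := by
  induction h with
  | nil => simp at hl
  | rel h => exact List.Lex.rel h
  | cons _ ih => exact List.Lex.cons (ih (by simpa using hl))

theorem wordRank_lt_of_lex {g h : FreeGroup X} {s s' t t' : List (X × Bool)}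
    (hn : norm g = norm h) (hg : half g.toWord = s ++ t) (hh : half h.toWord = s' ++ t')
    (hl : s.length = s'.length) (hlex : List.Lex WellOrderingRel s s') :
    wordRank g < wordRank h := by
  refine IsWellFounded.rank_lt_of_rel (Prod.lex_def.2 (Or.inr ⟨hn, ?_⟩))
  refine List.Shortlex.of_lex ?_ ?_
  · simp only [half, List.length_take, List.length_reverse]
    change min (norm g / 2) (norm g) = min (norm h / 2) (norm h)
    rw [hn]
  · simp only [hg, hh]
    exact lex_append_of_length_eq _ _ hlex hl

/-- `g'` is smaller than `g`, when an element is compared together with its inverse. -/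
def Smaller (g' g : FreeGroup X) : Prop :=
  (wordRank g' ≤ wordRank g ∧ wordRank g'⁻¹ ≤ wordRank g⁻¹) ∧
    (wordRank g' < wordRank g ∨ wordRank g'⁻¹ < wordRank g⁻¹)

theorem smaller_inv_iff {g' g : FreeGroup X} : Smaller g'⁻¹ g⁻¹ ↔ Smaller g' g := by
  simp only [Smaller, inv_inv]
  tauto

theorem smaller_of_norm_lt {g' g : FreeGroup X} (h : norm g' < norm g) : Smaller g' g := by
  have h1 := wordRank_lt_of_norm_lt h
  have h2 : wordRank g'⁻¹ < wordRank g⁻¹ :=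
    wordRank_lt_of_norm_lt (by rwa [norm_inv_eq, norm_inv_eq])
  exact ⟨⟨h1.le, h2.le⟩, Or.inl h1⟩

theorem length_toWord_eq (g : FreeGroup X) : g.toWord.length = norm g := rfl

/-- Passing from `g` to `g * h` replaces the suffix `c` by `q`. A shorter `q` would lower the
length; a `q` of equal length but lexicographically smaller would lower the last half, and leave the
first half as it is when `|c| ≤ |p|`. -/
theorem Cancels.right_of_not_smaller_mul {g h : FreeGroup X} {p c q : List (X × Bool)}
    (H : Cancels g h p c q) (hs : ¬ Smaller (g * h) g) :
    c.length ≤ q.length ∧ (c.length ≤ p.length → c.length = q.length →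
      ¬ List.Lex WellOrderingRel q.reverse c.reverse) := by
  have h1 : norm g = p.length + c.length := by rw [← length_toWord_eq, H.left, List.length_append]
  have h2 : norm (g * h) = p.length + q.length := by
    rw [← length_toWord_eq, H.mul, List.length_append]
  constructor
  · by_contra! hlt
    exact hs (smaller_of_norm_lt (by omega))
  · intro hcp hcq hlex
    have hn : norm (g * h) = norm g := by omega
    have h3 : wordRank (g * h) < wordRank g := by
      refine wordRank_lt_of_lex hn (by rw [H.mul, half_append (by omega)])
        (by rw [H.left, half_append hcp]) (by simp [hcq]) hlex
    have h4 : wordRank (g * h)⁻¹ = wordRank g⁻¹ := by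
      rw [wordRank, wordRank, norm_inv_eq, norm_inv_eq, hn, toWord_inv, toWord_inv, H.mul, H.left,
        half_invRev_append hcp, half_invRev_append (by omega), hcq]
    exact hs ⟨⟨h3.le, h4.le⟩, Or.inl h3⟩

theorem smaller_conj_of_length_lt {g h : FreeGroup X} {u u' : List (X × Bool)} {t : X × Bool}
    (hg : g.toWord = invRev u ++ [t] ++ u) (hu : FreeGroup.mk u * h = FreeGroup.mk u')
    (hl : u'.length < u.length) :
    Smaller (h⁻¹ * g * h) g := by
  have e : h⁻¹ * g * h = FreeGroup.mk (invRev u' ++ [t] ++ u') := by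
    rw [← mk_toWord (x := g), hg]
    simp only [← mul_mk, ← inv_mk]
    rw [← hu]
    group
  refine smaller_of_norm_lt ?_
  have h1 : norm (h⁻¹ * g * h) ≤ (invRev u' ++ [t] ++ u').length := e ▸ norm_mk_le
  have h2 : norm g = u.length + 1 + u.length := by
    rw [← length_toWord_eq, hg]; simp; omega
  simp at h1
  omega

/-- The length of `g` is odd, so `|c| ≤ |p|` puts `c` inside `u`, say `u = p' c`. Conjugation by `h`
then replaces `u` by `p' q`, and `u` is exactly the half that the rank looks at. -/
theorem Cancels.right_of_not_smaller_conj {g h : FreeGroup X} {p c q u : List (X × Bool)}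
    {t : X × Bool} (H : Cancels g h p c q) (hg : g.toWord = invRev u ++ [t] ++ u)
    (hs : ¬ Smaller (h⁻¹ * g * h) g) (hcp : c.length ≤ p.length) :
    c.length ≤ q.length ∧ (c.length = q.length →
      ¬ List.Lex WellOrderingRel q.reverse c.reverse) := by
  have hgl := congrArg List.length (H.left.symm.trans hg)
  simp only [List.length_append, invRev_length, List.length_singleton] at hgl
  obtain ⟨p', rfl⟩ : c <:+ u := by
    refine List.suffix_of_suffix_length_le (l₃ := g.toWord) ?_ ?_ (by omega)
    · rw [H.left]; exact List.suffix_append _ _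
    · rw [hg]; exact List.suffix_append _ _
  have hmul : FreeGroup.mk (p' ++ c) * h = FreeGroup.mk (p' ++ q) := by
    rw [← mk_toWord (x := h), H.right]
    simp only [← mul_mk, ← inv_mk]
    group
  constructor
  · by_contra! hlt
    exact hs (smaller_conj_of_length_lt hg hmul (by simpa using hlt))
  · intro hcq hlex
    have e : h⁻¹ * g * h = FreeGroup.mk (invRev (p' ++ q) ++ [t] ++ (p' ++ q)) := by
      conv_lhs => rw [← mk_toWord (x := g), hg]
      simp only [← mul_mk, ← inv_mk] at hmul ⊢
      rw [← hmul]
      group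
    have hn2 : norm g = (invRev (p' ++ q) ++ [t] ++ (p' ++ q)).length := by
      rw [← length_toWord_eq, hg]; simp; omega
    -- The new word need not be reduced, but if it is not, the conjugate is shorter than `g` and
    -- nothing more is needed.
    rcases toWord_mk_eq_or_norm_lt (invRev (p' ++ q) ++ [t] ++ (p' ++ q)) with h1 | h1
    · rw [← e] at h1
      have hn : norm (h⁻¹ * g * h) = norm g := by rw [← length_toWord_eq, h1, hn2]
      have a1 : wordRank (h⁻¹ * g * h) < wordRank g := by
        refine wordRank_lt_of_lex (s := q.reverse) (s' := c.reverse) (t := p'.reverse)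
          (t' := p'.reverse) hn ?_ ?_ (by simp [hcq]) hlex
        · rw [h1, half_conj, List.reverse_append]
        · rw [hg, half_conj, List.reverse_append]
      have a2 : wordRank (h⁻¹ * g * h)⁻¹ < wordRank g⁻¹ := by
        refine wordRank_lt_of_lex (s := q.reverse) (s' := c.reverse) (t := p'.reverse)
          (t' := p'.reverse) (by rw [norm_inv_eq, norm_inv_eq, hn]) ?_ ?_ (by simp [hcq]) hlex
        · rw [toWord_inv, h1, invRev_conj, half_conj, List.reverse_append]
        · rw [toWord_inv, hg, invRev_conj, half_conj, List.reverse_append]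
      exact hs ⟨⟨a1.le, a2.le⟩, Or.inl a1⟩
    · rw [← e, ← hn2] at h1
      exact hs (smaller_of_norm_lt h1)

/-- Here `u⁻¹` begins with `u'⁻¹ t'`. Writing `u⁻¹ = u'⁻¹ t' s` gives `u h = s⁻¹ u'`, a word one
letter shorter than `u`, and this is the new conjugator. -/
theorem Cancels.smaller_conj_of_length_lt {g h : FreeGroup X} {p c q u u' : List (X × Bool)}
    {t t' : X × Bool} (H : Cancels g h p c q) (hg : g.toWord = invRev u ++ [t] ++ u)
    (hh : h.toWord = invRev u' ++ [t'] ++ u') (huc : u.length ≤ c.length)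
    (hl : u'.length < u.length) : Smaller (h⁻¹ * g * h) g := by
  obtain ⟨c', rfl⟩ : u <:+ c := by
    refine List.suffix_of_suffix_length_le (l₃ := g.toWord) ?_ ?_ huc
    · rw [hg]; exact List.suffix_append _ _
    · rw [H.left]; exact List.suffix_append _ _
  obtain ⟨s, hs⟩ : invRev u' ++ [t'] <+: invRev u := by
    refine List.prefix_of_prefix_length_le (l₃ := h.toWord) ?_ ?_ (by simp; omega)
    · rw [hh]; exact List.prefix_append _ _
    · rw [H.right, invRev_append, List.append_assoc]; exact List.prefix_append _ _
  have hu : FreeGroup.mk u = (FreeGroup.mk (invRev u' ++ [t'] ++ s))⁻¹ := by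
    rw [hs, inv_mk, invRev_invRev]
  refine ZMC.smaller_conj_of_length_lt (u' := invRev s ++ u') hg ?_ ?_
  · rw [hu]
    conv_lhs => rw [← mk_toWord (x := h), hh]
    simp only [← mul_mk, ← inv_mk]
    group
  · have := congrArg List.length hs
    simp at this ⊢
    omega

/-- Suppose more than half of both words cancels. If the conjugators differ in length, the longer
one can be shortened by the other factor. If they agree in length, the middle letters cancel against
each other, which `ht` forbids; in the application both are positive letters. -/
theorem Cancels.length_le_or_of_letterConj {g h : FreeGroup X} {p c q u u' : List (X × Bool)}
    {t t' : X × Bool} (H : Cancels g h p c q) (hg : g.toWord = invRev u ++ [t] ++ u)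
    (hh : h.toWord = invRev u' ++ [t'] ++ u') (ht : t' ≠ (t.1, !t.2))
    (hs : ¬ Smaller (h⁻¹ * g * h) g) (hs' : ¬ Smaller (g * h * g⁻¹) h) :
    c.length ≤ p.length ∨ c.length ≤ q.length := by
  by_contra! hc
  have hgl := congrArg List.length (H.left.symm.trans hg)
  have hhl := congrArg List.length (H.right.symm.trans hh)
  simp only [List.length_append, invRev_length, List.length_singleton] at hgl hhl
  rcases lt_trichotomy u'.length u.length with hl | hl | hl
  · exact hs (H.smaller_conj_of_length_lt hg hh (by omega) hl)
  · have h1 : invRev u ++ [(t.1, !t.2)] <+: h.toWord := by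
      refine (List.prefix_of_prefix_length_le (l₂ := invRev c) (l₃ := (g⁻¹).toWord) ?_ ?_ ?_).trans
        (H.right ▸ List.prefix_append _ _)
      · rw [toWord_inv, hg, invRev_conj]
        exact List.prefix_append _ _
      · rw [H.symm.right]
        exact List.prefix_append _ _
      · simp; omega
    have h2 : invRev u' ++ [t'] <+: h.toWord := by
      rw [hh]; exact List.prefix_append _ _
    have h3 : invRev u ++ [(t.1, !t.2)] = invRev u' ++ [t'] :=
      (List.prefix_of_prefix_length_le h1 h2 (by simp [hl])).eq_of_length (by simp [hl])
    have := List.append_inj_right' h3 rfl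
    simp only [List.cons.injEq, and_true] at this
    exact ht this.symm
  · have := H.symm.smaller_conj_of_length_lt (u := u') (u' := u) (t := (t'.1, !t'.2))
      (t' := (t.1, !t.2)) (by rw [toWord_inv, hh, invRev_conj])
      (by rw [toWord_inv, hg, invRev_conj]) (by omega) hl
    rw [← smaller_inv_iff] at this
    exact hs' (by simpa [mul_assoc] using this)

/-- `g` cannot be made smaller by its right neighbour `h`. -/
def RightStable (T : Set (X × Bool)) (g h : FreeGroup X) : Prop :=
  ¬ Smaller (g * h) g ∨
    (∃ u, ∃ t ∈ T, g.toWord = invRev u ++ [t] ++ u) ∧ ¬ Smaller (h⁻¹ * g * h) g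

/-- `h` cannot be made smaller by its left neighbour `g`. -/
def LeftStable (T : Set (X × Bool)) (g h : FreeGroup X) : Prop :=
  ¬ Smaller (g * h) h ∨
    (∃ u, ∃ t ∈ T, h.toWord = invRev u ++ [t] ++ u) ∧ ¬ Smaller (g * h * g⁻¹) h

theorem LeftStable.inv {T : Set (X × Bool)} {g h : FreeGroup X} (H : LeftStable T g h) :
    RightStable ((fun t => (t.1, !t.2)) '' T) h⁻¹ g⁻¹ := by
  rcases H with H | ⟨⟨u, t, ht, hu⟩, H⟩
  · left
    rwa [← mul_inv_rev, smaller_inv_iff]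
  · right
    refine ⟨⟨u, _, ⟨t, ht, rfl⟩, ?_⟩, ?_⟩
    · rw [toWord_inv, hu, invRev_conj]
    · rw [← smaller_inv_iff]
      simpa [mul_assoc] using H

theorem Cancels.right_of_rightStable {T : Set (X × Bool)} {g h : FreeGroup X}
    {p c q : List (X × Bool)} (H : Cancels g h p c q) (hs : RightStable T g h)
    (hcp : c.length ≤ p.length) : c.length ≤ q.length ∧ (c.length = q.length →
      ¬ List.Lex WellOrderingRel q.reverse c.reverse) := by
  rcases hs with hs | ⟨⟨u, t, -, hu⟩, hs⟩
  · exact ⟨(H.right_of_not_smaller_mul hs).1, (H.right_of_not_smaller_mul hs).2 hcp⟩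
  · exact H.right_of_not_smaller_conj hu hs hcp

theorem Cancels.left_of_leftStable {T : Set (X × Bool)} {g h : FreeGroup X}
    {p c q : List (X × Bool)} (H : Cancels g h p c q) (hs : LeftStable T g h)
    (hcq : c.length ≤ q.length) : c.length ≤ p.length ∧ (c.length = p.length →
      ¬ List.Lex WellOrderingRel (invRev p).reverse c.reverse) := by
  have := H.symm.right_of_rightStable hs.inv (by simpa using hcq)
  simpa using this

/-- The cancellation between two neighbours affects at most half of each of them, and a half that
cancels completely is smaller than the other half. -/
structure TameCancels (g h : FreeGroup X) (p c q : List (X × Bool)) : Prop extends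
    Cancels g h p c q where
  le_left : c.length ≤ p.length
  le_right : c.length ≤ q.length
  lex_left : c.length = p.length → ¬ List.Lex WellOrderingRel (invRev p).reverse c.reverse
  lex_right : c.length = q.length → ¬ List.Lex WellOrderingRel q.reverse c.reverse

theorem exists_tameCancels {T : Set (X × Bool)} {g h : FreeGroup X}
    (hT : ∀ t ∈ T, ∀ t' ∈ T, t' ≠ (t.1, !t.2)) (hr : RightStable T g h)
    (hl : LeftStable T g h) : ∃ p c q, TameCancels g h p c q := by
  obtain ⟨p, c, q, H⟩ := exists_cancels g h
  -- One of the two bounds is enough, because stability on either side converts it into the other.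
  -- The case of two `t`-letters is the only one that stability under multiplication does not
  -- settle.
  have key : c.length ≤ p.length ∨ c.length ≤ q.length := by
    rcases hr with hr | ⟨⟨u, t, ht, hu⟩, hr⟩
    · exact Or.inr (H.right_of_not_smaller_mul hr).1
    · rcases hl with hl | ⟨⟨u', t', ht', hu'⟩, hl⟩
      · left
        have := (H.symm.right_of_not_smaller_mul (by rwa [← mul_inv_rev, smaller_inv_iff])).1
        simpa using this
      · exact H.length_le_or_of_letterConj hu hu' (hT t ht t' ht') hr hl
  refine ⟨p, c, q, ?_⟩
  rcases key with h1 | h1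
  · have h2 := H.right_of_rightStable hr h1
    have h3 := H.left_of_leftStable hl h2.1
    exact ⟨H, h3.1, h2.1, h3.2, h2.2⟩
  · have h3 := H.left_of_leftStable hl h1
    have h2 := H.right_of_rightStable hr h3.1
    exact ⟨H, h3.1, h2.1, h3.2, h2.2⟩

end Words

/-! ### Balanced factors and the staircase -/

section Words

variable {X : Type u}

theorem eq_of_not_lex_reverse {a b : List (X × Bool)}
    (h : ¬ List.Lex WellOrderingRel a.reverse b.reverse)
    (h' : ¬ List.Lex WellOrderingRel b.reverse a.reverse) : a = b := by
  have : Std.Trichotomous (List.Lex (WellOrderingRel (α := X × Bool))) := inferInstance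
  exact List.reverse_injective (Std.Trichotomous.trichotomous _ _ h h')

theorem isReduced_flatten_range {m : ℕ → List (X × Bool)} {n : ℕ} (hne : ∀ k < n, m k ≠ [])
    (hred : ∀ k < n, IsReduced (m k)) (hj : ∀ k, k + 1 < n → IsReduced (m k ++ m (k + 1))) :
    IsReduced ((List.range n).map m).flatten := by
  rw [FreeGroup.IsReduced, List.isChain_flatten]
  · refine ⟨?_, ?_⟩
    · intro l hl
      obtain ⟨k, hk, rfl⟩ := List.mem_map.1 hl
      exact hred k (List.mem_range.1 hk)
    · rw [List.isChain_iff_getElem]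
      intro i hi
      simp only [List.length_map, List.length_range] at hi
      simp only [List.getElem_map, List.getElem_range]
      exact (List.isChain_append.1 (hj i hi)).2.2
  · intro h
    obtain ⟨k, hk, h⟩ := List.mem_map.1 h
    exact hne k (List.mem_range.1 hk) h

variable [DecidableEq X]

/-- A shortest conjugator cannot begin with `y` or `y⁻¹`, since that letter commutes with `y` and
could be dropped; hence the displayed word is reduced. -/
theorem exists_toWord_eq_of_isConj {g : FreeGroup X} {y : X} (h : IsConj g (of y)) :
    ∃ u, g.toWord = invRev u ++ [(y, true)] ++ u := by
  let S : Set (FreeGroup X) := {x | g = x⁻¹ * of y * x}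
  have hS : S.Nonempty := by
    obtain ⟨x, hx⟩ := isConj_iff.1 h
    exact ⟨x, by rw [Set.mem_ofPred_eq, ← hx]; group⟩
  let x := Function.argminOn FreeGroup.norm S hS
  have hx : g = x⁻¹ * of y * x := Function.argminOn_mem FreeGroup.norm S hS
  have hmin : ∀ z, g = z⁻¹ * of y * z → norm x ≤ norm z := fun z hz =>
    Function.argminOn_le FreeGroup.norm S hz
  have hred : IsReduced (invRev x.toWord ++ [(y, true)] ++ x.toWord) := by
    have hx1 : IsReduced x.toWord := isReduced_toWord
    have hx2 : IsReduced (invRev x.toWord) := by rw [← toWord_inv]; exact isReduced_toWord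
    rcases hu : x.toWord with _ | ⟨a, u⟩
    · simp
    · have ha : a.1 ≠ y := by
        intro hay
        have hxa : x = FreeGroup.mk [a] * FreeGroup.mk u := by
          rw [mul_mk, ← mk_toWord (x := x), hu]; rfl
        have hcomm : (FreeGroup.mk [a])⁻¹ * of y * FreeGroup.mk [a] = of y := by
          obtain ⟨a1, _ | _⟩ := a
          · obtain rfl : a1 = y := hay
            have : FreeGroup.mk [(a1, false)] = (of a1)⁻¹ := rfl
            rw [this]; group
          · obtain rfl : a1 = y := hay
            have : FreeGroup.mk [(a1, true)] = of a1 := rfl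
            rw [this]; group
        have := hmin (FreeGroup.mk u) (by
          rw [hx, hxa, mul_inv_rev, ← hcomm]
          conv_rhs => rw [← hcomm]
          group)
        have h1 : norm (FreeGroup.mk u) ≤ u.length := norm_mk_le
        have h2 : norm x = u.length + 1 := by rw [← length_toWord_eq, hu]; rfl
        omega
      rw [hu] at hx1 hx2
      refine isReduced_append_of_isReduced (isReduced_append_of_isReduced hx2 (by simp) ?_) hx1 ?_
      · intro b hb b' hb' hbb
        obtain rfl : (y, true) = b' := by simpa using hb'
        have : (a.1, !a.2) = b := by
          simpa [invRev] using hb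
        exact absurd (by rw [← this] at hbb; exact hbb) ha
      · intro b hb b' hb' hbb
        obtain rfl : (y, true) = b := by simpa using hb
        obtain rfl : a = b' := by simpa using hb'
        exact absurd hbb.symm ha
  refine ⟨x.toWord, ?_⟩
  rw [← hred.reduce_eq, ← toWord_mk]
  conv_lhs => rw [hx]
  simp only [← mul_mk, ← inv_mk, mk_toWord]
  rfl

theorem eq_one_of_toWord_eq {g : FreeGroup X} {a : List (X × Bool)}
    (h : g.toWord = invRev a ++ a) : g = 1 := by
  rw [← mk_toWord (x := g), h, ← mul_mk, ← inv_mk, inv_mul_cancel]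

/-- The word `w` is `a⁻¹ m b`, where neither `a` nor `b` is more than half of `w`, and a half is not
larger than the other half. -/
structure Balanced (w a m b : List (X × Bool)) : Prop where
  eq : w = invRev a ++ m ++ b
  le_left : a.length ≤ m.length + b.length
  le_right : b.length ≤ a.length + m.length
  lex_left : a.length = m.length + b.length →
    ¬ List.Lex WellOrderingRel (m ++ b).reverse a.reverse
  lex_right : b.length = a.length + m.length →
    ¬ List.Lex WellOrderingRel (invRev m ++ a).reverse b.reverse

/-- The two cancelled ends do not overlap. If they filled the whole word they would be equally long
halves, neither smaller than the other, so `a = b` and `g = a⁻¹ a = 1`. The tie-break by halves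
exists to exclude this case. -/
theorem exists_balanced {g : FreeGroup X} (hg : g ≠ 1) {a b p q : List (X × Bool)}
    (hq : g.toWord = invRev a ++ q) (hp : g.toWord = p ++ b)
    (ha : a.length ≤ q.length) (hb : b.length ≤ p.length)
    (hla : a.length = q.length → ¬ List.Lex WellOrderingRel q.reverse a.reverse)
    (hlb : b.length = p.length → ¬ List.Lex WellOrderingRel (invRev p).reverse b.reverse) :
    ∃ m, m ≠ [] ∧ q = m ++ b ∧ p = invRev a ++ m ∧ Balanced g.toWord a m b := by
  have hlen := congrArg List.length (hq.symm.trans hp)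
  simp only [List.length_append, invRev_length] at hlen
  obtain ⟨m, rfl⟩ : b <:+ q := by
    refine List.suffix_of_suffix_length_le (l₃ := g.toWord) ?_ ?_ (by omega)
    · rw [hp]; exact List.suffix_append _ _
    · rw [hq]; exact List.suffix_append _ _
  have hpm : p = invRev a ++ m := by
    have := hq.symm.trans hp
    rw [← List.append_assoc] at this
    exact (List.append_cancel_right this).symm
  subst hpm
  refine ⟨m, ?_, rfl, rfl, ⟨hp, by simpa using ha, by simpa using hb, by simpa using hla,
    by simpa using hlb⟩⟩
  rintro rfl
  simp only [List.nil_append, List.append_nil, invRev_length, invRev_invRev] at *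
  have hab := eq_of_not_lex_reverse (hla (by omega)) (hlb (by omega))
  subst hab
  exact hg (eq_one_of_toWord_eq hq)

/-- Both decompositions split the word of `g` at one letter, and the end lengths in each differ by
at most one. If the splits differed, each would have an end equal to a full half; the lexicographic
conditions would make the two halves inverse to each other and `g` trivial. -/
theorem Balanced.eq_of_inv {g : FreeGroup X} (hg : g ≠ 1) {a b a' b' : List (X × Bool)}
    {m m' : X × Bool} (h : Balanced g.toWord a [m] b) (h' : Balanced g⁻¹.toWord a' [m'] b') :
    a = b' := by
  have h1 := h.eq
  have h2 := h'.eq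
  rw [toWord_inv] at h2
  replace h2 := congrArg invRev h2
  simp only [invRev_invRev, invRev_append] at h2
  have e := h1.symm.trans h2
  have hlen := congrArg List.length e
  have l1 := h.le_left
  have l2 := h.le_right
  have l3 := h'.le_left
  have l4 := h'.le_right
  have hr := h.lex_right
  have hl := h.lex_left
  have hr' := h'.lex_right
  have hl' := h'.lex_left
  simp only [List.length_append, invRev_length, List.length_singleton] at *
  by_cases hab : a.length = b'.length
  · rw [List.append_assoc] at e
    exact invRev_injective (List.append_inj_left e (by simp [hab]))
  exfalso
  rcases lt_or_gt_of_ne (show a.length ≠ b.length by omega) with hlt | hlt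
  · have e1 : invRev a ++ [m] = invRev b' := List.append_inj_left e (by simp; omega)
    have e2 : b = invRev [m'] ++ a' := List.append_inj_right e (by simp; omega)
    have e3 : b' = invRev [m] ++ a := by
      rw [← invRev_invRev (L₁ := b'), ← e1, invRev_append, invRev_invRev]
    have := hr (by omega)
    have := hr' (by omega)
    rw [← e2] at this
    rw [← e3] at *
    have hbb : b = b' := eq_of_not_lex_reverse ‹_› ‹_›
    rw [e1, hbb] at h1
    exact hg (eq_one_of_toWord_eq h1)
  · rw [List.append_assoc, ← List.append_assoc (invRev b')] at e
    have e1 : invRev a = invRev b' ++ invRev [m'] := List.append_inj_left e (by simp; omega)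
    have e2 : [m] ++ b = a' := List.append_inj_right e (by simp; omega)
    have e3 : a = [m'] ++ b' := by
      rw [← invRev_invRev (L₁ := a), e1, invRev_append, invRev_invRev, invRev_invRev]
    have t1 := hl (by omega)
    have t2 := hl' (by omega)
    rw [e2] at t1
    rw [← e3] at t2
    have haa : a = a' := eq_of_not_lex_reverse t2 t1
    rw [List.append_assoc, e2, ← haa] at h1
    exact hg (eq_one_of_toWord_eq h1)

/-- If the neighbours in a product of `n` nontrivial factors cancel tamely and the product has
length at most `n`, then exactly one letter of each factor survives. -/
theorem exists_staircase {n : ℕ} {G : ℕ → FreeGroup X} (hne : ∀ k < n, G k ≠ 1)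
    (ht : ∀ k, k + 1 < n → ∃ p c q, TameCancels (G k) (G (k + 1)) p c q)
    (hn : norm ((List.range n).map G).prod ≤ n) :
    ∃ c : ℕ → List (X × Bool), c 0 = [] ∧ c n = [] ∧
      ∀ k < n, ∃ x ∈ ((List.range n).map G).prod.toWord,
        Balanced (G k).toWord (c k) [x] (c (k + 1)) := by
  choose! P C Q H using ht
  -- `c k` is what cancels between the factors `k - 1` and `k`; nothing cancels at the outer ends
  -- `0` and `n`.
  let c : ℕ → List (X × Bool) := fun k => if 0 < k ∧ k < n then C (k - 1) else []
  have c0 : c 0 = [] := by simp [c]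
  have cn : c n = [] := by simp [c]
  have cs : ∀ k, k + 1 < n → c (k + 1) = C k := fun k hk => by simp [c, hk]
  have hG : ∀ k < n, 0 < (G k).toWord.length := fun k hk => by
    rw [List.length_pos_iff, ne_eq, toWord_eq_nil_iff]; exact hne k hk
  have hq : ∀ k < n, ∃ q, (G k).toWord = invRev (c k) ++ q ∧ (c k).length ≤ q.length ∧
      ((c k).length = q.length → ¬ List.Lex WellOrderingRel q.reverse (c k).reverse) ∧
      ∀ j, j + 1 = k → q = Q j := by
    intro k hk
    rcases k with _ | k
    · refine ⟨(G 0).toWord, by simp [c0], by simp [c0], fun h => ?_, fun j hj => by omega⟩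
      have := hG 0 hk
      rw [c0] at h
      simp at h
      omega
    · have := H k hk
      refine ⟨Q k, by rw [cs k hk]; exact this.right, by rw [cs k hk]; exact this.le_right,
        by rw [cs k hk]; exact this.lex_right, ?_⟩
      rintro j hj
      obtain rfl : j = k := by omega
      rfl
  have hp : ∀ k < n, ∃ p, (G k).toWord = p ++ c (k + 1) ∧ (c (k + 1)).length ≤ p.length ∧
      ((c (k + 1)).length = p.length →
        ¬ List.Lex WellOrderingRel (invRev p).reverse (c (k + 1)).reverse) ∧
      (k + 1 < n → p = P k) := by
    intro k hk
    by_cases hk' : k + 1 < n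
    · have := H k hk'
      exact ⟨P k, by rw [cs k hk']; exact this.left, by rw [cs k hk']; exact this.le_left,
        by rw [cs k hk']; exact this.lex_left, fun _ => rfl⟩
    · obtain rfl : k + 1 = n := by omega
      refine ⟨(G k).toWord, by simp [cn], by simp [cn], fun h => ?_, fun h => by omega⟩
      have := hG k hk
      rw [cn] at h
      simp at h
      omega
  have hm : ∀ k < n, ∃ m, m ≠ [] ∧ Balanced (G k).toWord (c k) m (c (k + 1)) ∧
      (k + 1 < n → P k = invRev (c k) ++ m) ∧ ∀ j, j + 1 = k → Q j = m ++ c (k + 1) := by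
    intro k hk
    obtain ⟨q, q1, q2, q3, q4⟩ := hq k hk
    obtain ⟨p, p1, p2, p3, p4⟩ := hp k hk
    obtain ⟨m, hm, hqm, hpm, hb⟩ := exists_balanced (hne k hk) q1 p1 q2 p2 q3 p3
    exact ⟨m, hm, hb, fun h => by rw [← p4 h, hpm], fun j hj => by rw [← q4 j hj, hqm]⟩
  choose! M M1 M2 M3 M4 using hm
  -- With `G k = (c k)⁻¹ M k c (k + 1)` the product telescopes.
  have hprod : ∀ k ≤ n, ((List.range k).map G).prod =
      FreeGroup.mk (((List.range k).map M).flatten ++ c k) := by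
    intro k hk
    induction k with
    | zero => simp [c0, one_eq_mk]
    | succ k ih =>
      rw [List.range_succ, List.map_append, List.prod_append, ih (by omega), List.map_append,
        List.flatten_append]
      simp only [List.map_cons, List.map_nil, List.prod_cons, List.prod_nil, mul_one,
        List.flatten_cons, List.flatten_nil, List.append_nil]
      conv_lhs => rw [← mk_toWord (x := G k), (M2 k (by omega)).eq]
      simp only [← mul_mk, ← inv_mk]
      group
  -- Since the pieces are nonempty, reducedness is a matter of adjacent pieces, and `M k ++ M (k +
  -- 1)` sits inside the reduced word of `G k * G (k + 1)`.
  have hred : IsReduced ((List.range n).map M).flatten := by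
    refine isReduced_flatten_range M1 (fun k hk => ?_) fun k hk => ?_
    · have h1 : IsReduced (G k).toWord := isReduced_toWord
      rw [(M2 k hk).eq] at h1
      exact h1.infix ⟨_, _, rfl⟩
    · have h1 : IsReduced (G k * G (k + 1)).toWord := isReduced_toWord
      rw [(H k hk).mul, M3 k (by omega) hk, M4 (k + 1) hk k rfl] at h1
      exact h1.infix ⟨invRev (c k), c (k + 1 + 1), by simp⟩
  have hword : ((List.range n).map G).prod.toWord = ((List.range n).map M).flatten := by
    rw [hprod n le_rfl, cn, List.append_nil, toWord_mk, hred.reduce_eq]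
  have hsum : ∑ k ∈ Finset.range n, (M k).length ≤ n := by
    rw [← length_toWord_eq, hword, List.length_flatten, List.map_map] at hn
    exact hn
  have hone : ∀ k < n, (M k).length = 1 := by
    intro k hk
    have hpos : ∀ i ∈ Finset.range n, 1 ≤ (M i).length := fun i hi =>
      List.length_pos_iff.2 (M1 i (Finset.mem_range.1 hi))
    by_contra h1
    have h2 := hpos k (Finset.mem_range.2 hk)
    have := Finset.sum_lt_sum hpos ⟨k, Finset.mem_range.2 hk, by omega⟩
    simp at this
    omega
  refine ⟨c, c0, cn, fun k hk => ?_⟩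
  obtain ⟨x, hx⟩ := List.length_eq_one_iff.1 (hone k hk)
  refine ⟨x, ?_, hx ▸ M2 k hk⟩
  rw [hword, List.mem_flatten]
  exact ⟨M k, List.mem_map_of_mem (List.mem_range.2 hk), by simp [hx]⟩

end Words

theorem stabilizesT_of_isConj {ψ : MulAut (F g p)} (π : Equiv.Perm (Fin p))
    (h : ∀ j, IsConj (ψ (of (Gen.t j))) (of (Gen.t (π j)))) : StabilizesT ψ := by
  have key : ∀ j, ConjClasses.map ψ.toMonoidHom (ConjClasses.mk (of (Gen.t j))) =
      ConjClasses.mk (of (Gen.t (π j))) := fun j => ConjClasses.mk_eq_mk_iff_isConj.2 (h j)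
  ext c
  constructor
  · rintro ⟨-, ⟨j, rfl⟩, rfl⟩
    exact ⟨π j, key j⟩
  · rintro ⟨j, rfl⟩
    refine ⟨_, ⟨π.symm j, rfl⟩, ?_⟩
    rw [key, Equiv.apply_symm_apply]

/-! ### Stable maps send letters to letters -/

section Rigid

variable {X : Type u} [DecidableEq X] {θ : F g p →* FreeGroup X}

theorem exists_conj_word_of_mem_tLetters
    (hconj : ∀ j : Fin p, ∃ y, IsConj (θ (of (Gen.t j))) (of y)) {a : Letter g p}
    (ha : a ∈ tLetters g p) :
    ∃ u, ∃ t ∈ {t : X × Bool | t.2 = true}, (θ a.elt).toWord = invRev u ++ [t] ++ u := by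
  obtain ⟨j, rfl⟩ := ha
  obtain ⟨y, hy⟩ := hconj j
  obtain ⟨u, hu⟩ := exists_toWord_eq_of_isConj hy
  exact ⟨u, (y, true), rfl, hu⟩

theorem elt_ne_one (z : Letter g p) : z.elt ≠ 1 := by
  obtain ⟨y, _ | _⟩ := z
  · rw [Letter.elt_false, ne_eq, inv_eq_one]
    exact of_ne_one y
  · exact of_ne_one y

/-- If no neighbour in a Zieschang list can shorten a letter, then every letter has length one. -/
theorem exists_toWord_eq_singleton_of_stable {L : List (Letter g p)} (hL : IsZieschangList L)
    (hθ : Function.Injective θ) (hconj : ∀ j : Fin p, ∃ y, IsConj (θ (of (Gen.t j))) (of y))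
    (hs : ∀ P Q a b, L = P ++ a :: b :: Q →
      RightStable {t : X × Bool | t.2 = true} (θ a.elt) (θ b.elt) ∧
      LeftStable {t : X × Bool | t.2 = true} (θ a.elt) (θ b.elt))
    (hn : FreeGroup.norm (θ (listElt L)) ≤ 4 * g + p) :
    ∀ z ∈ L, ∃ x ∈ (θ (listElt L)).toWord, (θ z.elt).toWord = [x] := by
  have hne : ∀ z : Letter g p, θ z.elt ≠ 1 := fun z hz =>
    elt_ne_one z (hθ (by rw [hz, _root_.map_one]))
  let G : ℕ → FreeGroup X := fun k => if h : k < L.length then θ (L[k]).elt else 1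
  have hG : ∀ k (h : k < L.length), G k = θ (L[k]).elt := fun k h => by simp [G, h]
  have hprod : ((List.range L.length).map G).prod = θ (listElt L) := by
    rw [listElt, map_list_prod, List.map_map]
    congr 1
    refine List.ext_getElem (by simp) fun i h1 h2 => ?_
    simp only [List.length_map, List.length_range] at h1
    simp [hG i h1]
  obtain ⟨c, c0, cn, hc⟩ := exists_staircase (n := L.length) (G := G)
    (fun k hk => by rw [hG k hk]; exact hne _) (fun k hk => by
      rw [hG k (by omega), hG (k + 1) hk]
      have := hs (L.take k) (L.drop (k + 2)) L[k] L[k + 1] (by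
        rw [← List.drop_eq_getElem_cons, ← List.drop_eq_getElem_cons, List.take_append_drop])
      refine exists_tameCancels ?_ this.1 this.2
      rintro t ht t' ht' rfl
      simp only [Set.mem_ofPred_eq] at ht ht'
      rw [ht] at ht'
      simp at ht') (by rw [hprod, hL.length_eq]; exact hn)
  rw [hprod] at hc
  choose x hx hB using hc
  -- cancellation at the two ends of a letter
  have hinv : ∀ k l (hk : k < L.length) (hl : l < L.length), (L[k]).inv = L[l] →
      c k = c (l + 1) := by
    intro k l hk hl hkl
    have h1 := hB k hk
    have h2 := hB l hl
    rw [hG k hk] at h1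
    rw [hG l hl, ← hkl, Letter.elt_inv, _root_.map_inv] at h2
    exact h1.eq_of_inv (hne _) h2
  -- The word `u⁻¹ t u` has odd length, so the two ends beside the single middle letter have equal
  -- length; both are then `u`.
  have ht : ∀ k (hk : k < L.length), L[k] ∈ tLetters g p → c k = c (k + 1) := by
    intro k hk hkt
    obtain ⟨u, t, -, hu⟩ := exists_conj_word_of_mem_tLetters hconj hkt
    have h1 := hB k hk
    rw [hG k hk] at h1
    have e := h1.eq.symm.trans hu
    have hlen := congrArg List.length e
    have l1 := h1.le_left
    have l2 := h1.le_right
    simp only [List.length_append, invRev_length, List.length_singleton] at hlen l1 l2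
    rw [List.append_assoc, List.append_assoc] at e
    have e1 : c k = u := invRev_injective (List.append_inj_left e (by simp; omega))
    have e2 := List.append_inj_right e (by simp; omega)
    rw [e1]
    exact (List.append_inj_right e2 rfl).symm
  -- The vertex `v_k` carries `c (k + 1)` and `v_k⁻¹` carries `c k`, and `S` says that the value is
  -- empty. When `v_k` and `v_k⁻¹` are both listed, `hinv` makes the two prescriptions agree; `ht`
  -- gives invariance along the `t`-edges.
  let S : Letter g p → Prop := fun z =>
    (∃ k, ∃ h : k < L.length, L[k] = z ∧ c (k + 1) = []) ∨
      ∃ k, ∃ h : k < L.length, (L[k]).inv = z ∧ c k = []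
  have hS1 : ∀ k (h : k < L.length), S L[k] ↔ c (k + 1) = [] := by
    intro k hk
    constructor
    · rintro (⟨l, hl, hlk, hcl⟩ | ⟨l, hl, hlk, hcl⟩)
      · rwa [← (hL.nodup.getElem_inj_iff).1 hlk]
      · rwa [← hinv l k hl hk hlk]
    · exact fun h => Or.inl ⟨k, hk, rfl, h⟩
  have hS2 : ∀ k (h : k < L.length), S (L[k]).inv ↔ c k = [] := by
    intro k hk
    constructor
    · rintro (⟨l, hl, hlk, hcl⟩ | ⟨l, hl, hlk, hcl⟩)
      · rwa [hinv k l hk hl hlk.symm]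
      · rwa [← (hL.nodup.getElem_inj_iff).1 (Letter.inv_injective hlk)]
    · exact fun h => Or.inr ⟨k, hk, rfl, h⟩
  have hconst := hL.connected S (by
    intro z hz
    obtain ⟨k, hk, rfl⟩ := List.mem_iff_getElem.1 ((hL.mem_iff z).2 (Or.inl hz))
    rw [hS1, hS2, ht k hk hz]) (by
    rw [List.isChain_iff_getElem]
    intro k hk
    rw [EdgeInvariant, hS1, hS2])
  intro z hz
  obtain ⟨k, hk, rfl⟩ := List.mem_iff_getElem.1 hz
  have hlast : S (L[L.length - 1]'(by omega)) := by
    rw [hS1, Nat.sub_add_cancel (by omega), cn]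
  have h1 : c (k + 1) = [] := (hS1 k hk).1 ((hconst _ _).1 hlast)
  have h2 : c k = [] := (hS2 k hk).1 ((hconst _ _).1 hlast)
  refine ⟨x k hk, hx k hk, ?_⟩
  have := (hB k hk).eq
  rw [h1, h2, hG k hk] at this
  simpa using this

end Rigid

/-! ### Permutations of letters: Nielsen edges of the first kind -/

section LetterMap

theorem mem_xLetters_iff {z : Letter g p} : z ∈ xLetters g p ↔ ∀ j, z.1 ≠ Gen.t j := by
  obtain ⟨j | i | i, b⟩ := z
  · refine ⟨?_, fun h => absurd rfl (h j)⟩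
    rintro ⟨i, b, h | h⟩ <;> simp at h
  · exact ⟨fun _ j => by simp, fun _ => ⟨i, b, Or.inl rfl⟩⟩
  · exact ⟨fun _ j => by simp, fun _ => ⟨i, b, Or.inr rfl⟩⟩

theorem IsZieschangList.map {L : List (Letter g p)} (hL : IsZieschangList L)
    {f : Letter g p → Letter g p} (hf : Function.Bijective f) (hinv : ∀ z, f z.inv = (f z).inv)
    (ht : f '' tLetters g p = tLetters g p) (hx : f '' xLetters g p = xLetters g p) :
    IsZieschangList (L.map f) := by
  refine ⟨hL.nodup.map hf.1, fun z => ?_, by rw [List.length_map, hL.length_eq], ?_⟩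
  · have : f '' posLetters g p = posLetters g p := by rw [Set.image_union, ht, hx]
    rw [List.mem_map, ← this]
    simp only [hL.mem_iff]
    rfl
  · intro S hS hc y z
    obtain ⟨y, rfl⟩ := hf.2 y
    obtain ⟨z, rfl⟩ := hf.2 z
    refine hL.connected (fun z => S (f z)) (fun z hz => ?_) ?_ y z
    · rw [hinv]
      exact hS _ (ht ▸ Set.mem_image_of_mem f hz)
    · rw [List.isChain_map] at hc
      refine hc.imp fun a b hab => ?_
      rw [EdgeInvariant] at hab ⊢
      rw [hinv]
      exact hab

theorem listElt_map {G : Type*} [FunLike G (F g p) (F g p)] [MonoidHomClass G (F g p) (F g p)]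
    {ψ : G} {f : Letter g p → Letter g p} (h : ∀ z, ψ z.elt = (f z).elt)
    (L : List (Letter g p)) : listElt (L.map f) = ψ (listElt L) := by
  rw [listElt, listElt, map_list_prod, List.map_map, List.map_map]
  congr 1
  exact List.map_congr_left fun z _ => (h z).symm

variable {X : Type u} [DecidableEq X] {θ : F g p →* FreeGroup X} {emb : Gen g p → X}

theorem mem_range_of_mem_toWord_map {W : F g p} {x : X × Bool}
    (hx : x ∈ (FreeGroup.map emb W).toWord) : ∃ y, emb y = x.1 := by
  rw [← mk_toWord (x := W), map.mk, toWord_mk] at hx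
  obtain ⟨y, -, rfl⟩ := List.mem_map.1 ((reduce.red.sublist).subset hx)
  exact ⟨y.1, rfl⟩

theorem exists_permutation_of_singletons {L : List (Letter g p)} {W : F g p}
    (hL : IsZieschangList L) (hemb : Function.Injective emb) (hθ : Function.Injective θ)
    (π : Equiv.Perm (Fin p))
    (hconj : ∀ j, IsConj (θ (of (Gen.t j))) (of (emb (Gen.t (π j)))))
    (hW : θ (listElt L) = FreeGroup.map emb W)
    (hone : ∀ z ∈ L, ∃ x ∈ (θ (listElt L)).toWord, (θ z.elt).toWord = [x]) :
    ∃ ψ : MulAut (F g p), IsN1 ψ ∧ StabilizesT ψ ∧ IsZieschang W ∧ ψ (listElt L) = W ∧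
      ∀ a, θ a = FreeGroup.map emb (ψ a) := by
  have hpos : ∀ y : Gen g p, ((y, true) : Letter g p) ∈ posLetters g p := by
    rintro (j | i | i)
    · exact Or.inl ⟨j, rfl⟩
    · exact Or.inr ⟨i, true, Or.inl rfl⟩
    · exact Or.inr ⟨i, true, Or.inr rfl⟩
  have hex : ∀ y : Gen g p, ∃ z : Letter g p, θ (of y) = FreeGroup.mk [(emb z.1, z.2)] := by
    intro y
    -- Because `x` occurs in the word of `map emb W`, it comes from a letter of `F`; this is why `θ`
    -- takes values in the embedded copy of `F`.
    obtain ⟨x, hx, hyx⟩ := hone (y, true) ((hL.mem_iff _).2 (hpos y))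
    rw [hW] at hx
    obtain ⟨y', hy'⟩ := mem_range_of_mem_toWord_map hx
    refine ⟨(y', x.2), ?_⟩
    rw [← mk_toWord (x := θ (of y))]
    rw [Letter.elt_true] at hyx
    rw [hyx, hy']
  choose f hf using hex
  have hinj : ∀ y y', (f y).1 = (f y').1 → y = y' := by
    intro y y' h
    by_cases h2 : (f y).2 = (f y').2
    · have : θ (of y) = θ (of y') := by rw [hf, hf, h, h2]
      exact of_injective (hθ this)
    · have : θ (of y) = θ (of y')⁻¹ := by
        rw [_root_.map_inv, hf, hf, h, inv_mk, Bool.eq_not_of_ne h2]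
        rfl
      have h3 := congrArg toWord (hθ this)
      rw [toWord_inv, toWord_of, toWord_of] at h3
      simp [invRev] at h3
  let lm : Letter g p → Letter g p := fun z => ((f z.1).1, if z.2 then (f z.1).2 else !(f z.1).2)
  have lm_inv : ∀ z, lm z.inv = (lm z).inv := by
    rintro ⟨y, _ | _⟩ <;> simp [lm, Letter.inv]
  have lm_inj : Function.Injective lm := by
    rintro ⟨y, b⟩ ⟨y', b'⟩ h
    have h1 := hinj _ _ (Prod.mk.inj h).1
    simp only at h1
    subst h1
    have h2 := (Prod.mk.inj h).2
    refine Prod.ext rfl ?_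
    cases b <;> cases b' <;> simp_all
  have lm_bij : Function.Bijective lm := Finite.injective_iff_bijective.1 lm_inj
  let ψ₀ : F g p →* F g p := FreeGroup.lift fun y => (f y).elt
  have hψ₀ : ∀ z : Letter g p, ψ₀ z.elt = (lm z).elt := by
    rintro ⟨y, _ | _⟩
    · rw [Letter.elt_false, _root_.map_inv]
      simp only [ψ₀, lift_apply_of, ← Letter.elt_inv]
      rfl
    · rw [Letter.elt_true]
      simp only [ψ₀, lift_apply_of]
      rfl
  have hθψ : ∀ a, θ a = FreeGroup.map emb (ψ₀ a) := by
    intro a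
    have : θ = (FreeGroup.map emb).comp ψ₀ := by
      refine FreeGroup.ext_hom _ _ fun y => ?_
      rw [MonoidHom.comp_apply]
      simp only [ψ₀, lift_apply_of, Letter.elt, map.mk, hf]
      rfl
    rw [this]
    rfl
  have hψinj : Function.Injective ψ₀ := fun a b hab => hθ (by rw [hθψ, hθψ, hab])
  have hψsurj : Function.Surjective ψ₀ := by
    rw [← MonoidHom.range_eq_top, eq_top_iff, ← closure_range_of, Subgroup.closure_le]
    rintro _ ⟨y, rfl⟩
    obtain ⟨z, hz⟩ := lm_bij.2 (y, true)
    exact ⟨z.elt, by rw [hψ₀, hz]; rfl⟩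
  let ψ : MulAut (F g p) := MulEquiv.ofBijective ψ₀ ⟨hψinj, hψsurj⟩
  have hψ : ∀ z : Letter g p, ψ z.elt = (lm z).elt := hψ₀
  have lm_t : ∀ j, lm (Gen.t j, true) = (Gen.t (π j), true) := by
    intro j
    obtain ⟨u, hu⟩ := exists_toWord_eq_of_isConj (hconj j)
    have h1 : (θ (of (Gen.t j))).toWord = [(emb (f (Gen.t j)).1, (f (Gen.t j)).2)] := by
      rw [hf, toWord_mk, reduce_singleton]
    have e := h1.symm.trans hu
    have hl := congrArg List.length e
    simp at hl
    obtain rfl : u = [] := List.length_eq_zero_iff.1 (by omega)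
    simp only [invRev_empty, List.nil_append, List.append_nil, List.cons.injEq, Prod.mk.injEq,
      and_true] at e
    simp only [lm, if_true]
    exact Prod.ext (hemb e.1) e.2
  have ht : lm '' tLetters g p = tLetters g p := by
    ext z
    constructor
    · rintro ⟨-, ⟨j, rfl⟩, rfl⟩
      exact ⟨π j, lm_t j⟩
    · rintro ⟨j, rfl⟩
      exact ⟨_, ⟨π.symm j, rfl⟩, by rw [lm_t, Equiv.apply_symm_apply]⟩
  have hft : ∀ y : Gen g p, (∃ j, (f y).1 = Gen.t j) ↔ ∃ j, y = Gen.t j := by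
    intro y
    have h1 : ∀ j, (f (Gen.t j)).1 = Gen.t (π j) := fun j => congrArg Prod.fst (lm_t j)
    constructor
    · rintro ⟨j, hj⟩
      exact ⟨π.symm j, hinj _ _ (by rw [hj, h1, Equiv.apply_symm_apply])⟩
    · rintro ⟨j, rfl⟩
      exact ⟨_, h1 j⟩
  have hx : lm '' xLetters g p = xLetters g p := by
    have hiff : ∀ z, lm z ∈ xLetters g p ↔ z ∈ xLetters g p := by
      intro z
      rw [mem_xLetters_iff, mem_xLetters_iff]
      have := not_congr (hft z.1)
      push Not at this
      exact this
    ext z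
    constructor
    · rintro ⟨y, hy, rfl⟩
      exact (hiff y).2 hy
    · intro hz
      obtain ⟨y, rfl⟩ := lm_bij.2 z
      exact ⟨y, (hiff y).1 hz, rfl⟩
  have himg : ∀ T : Set (Letter g p), ψ '' (Letter.elt '' T) = Letter.elt '' (lm '' T) := by
    intro T
    rw [Set.image_image, Set.image_image]
    simp only [hψ]
  have hψW : ψ (listElt L) = W := by
    refine map_injective hemb ?_
    rw [← hW, hθψ]
    rfl
  refine ⟨ψ, ⟨by rw [himg, ht], by rw [himg, hx]⟩, stabilizesT_of_isConj π fun j => ?_, ?_,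
    hψW, hθψ⟩
  · have : ψ (of (Gen.t j)) = of (Gen.t (π j)) := by
      rw [← Letter.elt_true, hψ, lm_t]
      rfl
    rw [this]
  · refine isZieschang_iff.2 ⟨L.map lm, hL.map lm_bij lm_inv ht hx, ?_⟩
    rw [listElt_map hψ, hψW]

end LetterMap

/-! ### Descent on the ranks of the letters -/

section Descent

variable {X : Type u} [DecidableEq X] {emb : Gen g p → X}

theorem wordRank_lt_of_smaller {θ : F g p →* FreeGroup X} {L L' : List (Letter g p)}
    {a : Letter g p} {ψ : MulAut (F g p)} (hψ : IsElementaryMove L L' a ψ)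
    (hs : Smaller (θ ((MulEquiv.symm ψ) a.elt)) (θ a.elt)) :
    (fun z : Letter g p => wordRank (θ ((MulEquiv.symm ψ) z.elt))) <
      fun z => wordRank (θ z.elt) := by
  rw [Pi.lt_def]
  constructor
  · intro z
    by_cases h : z.1 = a.1
    · by_cases h1 : z = a
      · subst h1
        exact hs.1.1
      · have : z = a.inv := by
          by_contra h2
          exact Letter.fst_ne_of_ne h1 h2 h
        subst this
        simpa only [Letter.elt_inv, _root_.map_inv] using hs.1.2
    · simp only [hψ.fixes z h, le_refl]
  · rcases hs.2 with h | h
    · exact ⟨a, h⟩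
    · exact ⟨a.inv, by simpa only [Letter.elt_inv, _root_.map_inv] using h⟩

/-- Well-founded induction on the rank function. An improving move `ψ` contributes one edge and
leaves `θ ψ⁻¹`, which still takes the new list to `W` and the `t`-letters to the same conjugacy
classes. If no move improves, all neighbours are stable and `θ` is a permutation of letters. -/
theorem exists_path_of_rank (hemb : Function.Injective emb) (π : Equiv.Perm (Fin p)) {W : F g p}
    (hn : FreeGroup.norm W ≤ 4 * g + p) (r : Letter g p → Ordinal.{u}) :
    ∀ (θ : F g p →* FreeGroup X) (L : List (Letter g p)) (hV : IsZieschang (listElt L)),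
      (fun z => wordRank (θ z.elt)) = r → IsZieschangList L → Function.Injective θ →
      (∀ j, IsConj (θ (of (Gen.t j))) (of (emb (Gen.t (π j))))) →
      θ (listElt L) = FreeGroup.map emb W →
      ∃ (hW : IsZieschang W) (φ : ZieschangHom (⟨listElt L, hV⟩ : Zieschang g p) ⟨W, hW⟩),
        φ ∈ (nielsenSubgroupoid g p).arrows ⟨listElt L, hV⟩ ⟨W, hW⟩ ∧
        ∀ a, θ a = FreeGroup.map emb (φ.aut a) := by
  induction r using WellFoundedLT.induction with
  | ind r ih =>
  intro θ L hV hr hL hθ hconj hW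
  by_cases hmove : ∃ L' a ψ, IsElementaryMove L L' a ψ ∧
      Smaller (θ ((MulEquiv.symm ψ) a.elt)) (θ a.elt)
  · obtain ⟨L', a, ψ, hψ, hs⟩ := hmove
    have hlt := wordRank_lt_of_smaller hψ hs
    rw [hr] at hlt
    have hV' : IsZieschang (listElt L') := isZieschang_iff.2 ⟨L', hψ.isZieschangList, rfl⟩
    have hθψ : ∀ b, (θ.comp (MulEquiv.symm ψ).toMonoidHom) (ψ b) = θ b := fun b =>
      congrArg θ (MulEquiv.symm_apply_apply ψ b)
    obtain ⟨hWz, φ, hφ, hφθ⟩ := ih _ hlt (θ.comp (MulEquiv.symm ψ).toMonoidHom) L' hV' rfl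
      hψ.isZieschangList (hθ.comp (MulEquiv.symm ψ).injective) (fun j => by
        refine IsConj.trans ?_ (hconj j)
        have := MonoidHom.map_isConj (θ.comp (MulEquiv.symm ψ).toMonoidHom) (hψ.conj j).symm
        rwa [hθψ] at this) (by rw [← hψ.map_listElt, hθψ, hW])
    have hst : StabilizesT ψ := stabilizesT_of_isConj (Equiv.refl _) hψ.conj
    let e : (⟨listElt L, hV⟩ : Zieschang g p) ⟶ ⟨listElt L', hV'⟩ := ⟨ψ, hst, hψ.map_listElt⟩
    let φ₁ : (⟨listElt L', hV'⟩ : Zieschang g p) ⟶ ⟨W, hWz⟩ := φ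
    refine ⟨hWz, e ≫ φ₁, ?_, fun a => ?_⟩
    · refine (nielsenSubgroupoid g p).mul ?_ hφ
      exact Subgroupoid.subset_generated _ _ _ (Or.inr hψ.nielsen)
    · rw [← hθψ, hφθ]
      rfl
  · have hs : ∀ P Q a b, L = P ++ a :: b :: Q →
        RightStable {t : X × Bool | t.2 = true} (θ a.elt) (θ b.elt) ∧
        LeftStable {t : X × Bool | t.2 = true} (θ a.elt) (θ b.elt) := by
      rintro P Q a b rfl
      have hc : ∀ j : Fin p, ∃ y, IsConj (θ (of (Gen.t j))) (of y) := fun j => ⟨_, hconj j⟩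
      constructor
      · rcases (hL.mem_iff a).1 (by simp) with ha | ha
        · right
          refine ⟨exists_conj_word_of_mem_tLetters hc ha, fun h => hmove ?_⟩
          obtain ⟨L', ψ, hψ, h1⟩ := exists_move_conj_right hL ha
          exact ⟨L', a, ψ, hψ, by simpa [h1] using h⟩
        · left
          refine fun h => hmove ?_
          obtain ⟨L', ψ, hψ, h1⟩ := exists_move_mul_right hL ha
          exact ⟨L', a, ψ, hψ, by simpa [h1] using h⟩
      · rcases (hL.mem_iff b).1 (by simp) with hb | hb
        · right
          refine ⟨exists_conj_word_of_mem_tLetters hc hb, fun h => hmove ?_⟩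
          obtain ⟨L', ψ, hψ, h1⟩ := exists_move_conj_left hL hb
          exact ⟨L', b, ψ, hψ, by simpa [h1] using h⟩
        · left
          refine fun h => hmove ?_
          obtain ⟨L', ψ, hψ, h1⟩ := exists_move_mul_left hL hb
          exact ⟨L', b, ψ, hψ, by simpa [h1] using h⟩
    have hnW : FreeGroup.norm (θ (listElt L)) ≤ 4 * g + p := by
      rw [hW]
      refine le_trans ?_ hn
      conv_lhs => rw [← mk_toWord (x := W), map.mk]
      refine norm_mk_le.trans ?_
      rw [List.length_map]
      rfl
    obtain ⟨ψ, h1, h2, h3, h4, h5⟩ := exists_permutation_of_singletons hL hemb hθ π hconj hW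
      (exists_toWord_eq_singleton_of_stable hL hθ (fun j => ⟨_, hconj j⟩) hs hnW)
    exact ⟨h3, ⟨ψ, h2, h4⟩, Subgroupoid.subset_generated _ _ _ (Or.inl h1), h5⟩

end Descent

/-- An injective homomorphism that carries a Zieschang element to a short element of the free
factor is a path of Nielsen edges. -/
theorem exists_nielsen_path {X : Type u} {emb : Gen g p → X} (hemb : Function.Injective emb)
    {θ : F g p →* FreeGroup X} (hθ : Function.Injective θ) {V W : F g p} (hV : IsZieschang V)
    (hn : FreeGroup.norm W ≤ 4 * g + p) (hVW : θ V = FreeGroup.map emb W)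
    (π : Equiv.Perm (Fin p))
    (hconj : ∀ j, IsConj (θ (of (Gen.t j))) (of (emb (Gen.t (π j))))) :
    ∃ (hW : IsZieschang W) (φ : ZieschangHom (⟨V, hV⟩ : Zieschang g p) ⟨W, hW⟩),
      φ ∈ (nielsenSubgroupoid g p).arrows ⟨V, hV⟩ ⟨W, hW⟩ ∧
      ∀ a, θ a = FreeGroup.map emb (φ.aut a) := by
  classical
  obtain ⟨L, hL, rfl⟩ := isZieschang_iff.1 hV
  exact exists_path_of_rank hemb π hn _ θ L hV rfl hL hθ hconj hVW

/-! ### Residual finiteness and the Hopf property -/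

section Hopfian

theorem tail_eq_of_append_eq {α : Type*} {w p p' l l' : List α} {x x' : α}
    (h : w = p ++ x :: l) (h' : w = p' ++ x' :: l') (hl : l.length = l'.length + 1) :
    l = x' :: l' := by
  have e : p ++ [x] ++ l = p' ++ x' :: l' := by rw [← h', h]; simp
  exact List.append_inj_right' e (by simp [hl])

variable {Y : Type*}

/-- How the generator `y` has to act on the positions of the word `w`. -/
def PositionRel (w : List (Y × Bool)) (y : Y) (i j : ℕ) : Prop :=
  ∃ p l b, w = p ++ (y, b) :: l ∧
    ((b = true ∧ i = l.length ∧ j = l.length + 1) ∨ (b = false ∧ i = l.length + 1 ∧ j = l.length))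

/-- Positions are counted by the length of the suffix that has already acted, as the rightmost
letter acts first. Adjacent letters on one generator have the same sign in a reduced word, so each
generator acts as a partial injection on positions. -/
theorem bool_eq_of_isReduced {w p p' l l' : List (Y × Bool)} {y : Y} {b b' : Bool}
    (hw : FreeGroup.IsReduced w) (h : w = p ++ (y, b) :: l) (h' : w = p' ++ (y, b') :: l')
    (hl : l.length = l'.length + 1) : b = b' := by
  have := tail_eq_of_append_eq h h' hl
  subst this
  rw [h] at hw
  exact (List.isChain_append_cons_cons.1 hw).2.1 rfl

theorem PositionRel.right_unique {w : List (Y × Bool)} {y : Y} {i j j' : ℕ}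
    (hw : FreeGroup.IsReduced w) (h : PositionRel w y i j) (h' : PositionRel w y i j') :
    j = j' := by
  obtain ⟨p, l, b, h, ⟨rfl, h1, h2⟩ | ⟨rfl, h1, h2⟩⟩ := h <;>
    obtain ⟨p', l', b', h', ⟨rfl, h1', h2'⟩ | ⟨rfl, h1', h2'⟩⟩ := h'
  · omega
  · exact absurd (bool_eq_of_isReduced hw h h' (by omega)) (by simp)
  · exact absurd (bool_eq_of_isReduced hw h' h (by omega)) (by simp)
  · omega

theorem PositionRel.left_unique {w : List (Y × Bool)} {y : Y} {i i' j : ℕ}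
    (hw : FreeGroup.IsReduced w) (h : PositionRel w y i j) (h' : PositionRel w y i' j) :
    i = i' := by
  obtain ⟨p, l, b, h, ⟨rfl, h1, h2⟩ | ⟨rfl, h1, h2⟩⟩ := h <;>
    obtain ⟨p', l', b', h', ⟨rfl, h1', h2'⟩ | ⟨rfl, h1', h2'⟩⟩ := h'
  · omega
  · exact absurd (bool_eq_of_isReduced hw h' h (by omega)) (by simp)
  · exact absurd (bool_eq_of_isReduced hw h h' (by omega)) (by simp)
  · omega

theorem PositionRel.lt {w : List (Y × Bool)} {y : Y} {i j : ℕ} (h : PositionRel w y i j) :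
    i < w.length + 1 ∧ j < w.length + 1 := by
  obtain ⟨p, l, b, rfl, h⟩ := h
  simp only [List.length_append, List.length_cons]
  omega

theorem exists_perm_extending_positionRel {w : List (Y × Bool)} (hw : FreeGroup.IsReduced w)
    (y : Y) : ∃ σ : Equiv.Perm (Fin (w.length + 1)), ∀ i j : Fin (w.length + 1),
      PositionRel w y i j → σ i = j := by
  classical
  have hex : ∀ i : Fin (w.length + 1), ∃ j : Fin (w.length + 1),
      (∃ k, PositionRel w y i k) → PositionRel w y i j := by
    intro i
    by_cases h : ∃ k, PositionRel w y i k
    · obtain ⟨k, hk⟩ := h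
      exact ⟨⟨k, hk.lt.2⟩, fun _ => hk⟩
    · exact ⟨0, fun h' => absurd h' h⟩
  choose f hf using hex
  obtain ⟨σ, hσ⟩ := Finset.exists_equiv_extend_of_card_eq (α := Fin (w.length + 1))
    (t := Finset.univ) (s := Finset.univ.filter fun i => ∃ k, PositionRel w y i k) (f := f)
    (by simp) (Finset.subset_univ _) (by
      intro i hi i' hi' h
      simp only [Finset.coe_filter, Finset.mem_univ, true_and, Set.mem_ofPred_eq] at hi hi'
      exact Fin.ext ((hf i hi).left_unique hw (h ▸ hf i' hi')))
  refine ⟨σ.trans (Equiv.subtypeUnivEquiv Finset.mem_univ), fun i j hij => ?_⟩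
  have h1 := hσ i (by simpa using ⟨_, hij⟩)
  have h2 := (hf i ⟨_, hij⟩).right_unique hw hij
  rw [Equiv.trans_apply, Equiv.subtypeUnivEquiv_apply, h1]
  exact Fin.ext h2

/-- Free groups are residually finite. -/
theorem exists_perm_hom_ne_one {x : FreeGroup Y} (hx : x ≠ 1) :
    ∃ (n : ℕ) (h : FreeGroup Y →* Equiv.Perm (Fin n)), h x ≠ 1 := by
  classical
  set w := x.toWord with hw
  have hred : FreeGroup.IsReduced w := isReduced_toWord
  choose σ hσ using exists_perm_extending_positionRel hred
  refine ⟨w.length + 1, FreeGroup.lift σ, fun h => hx ?_⟩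
  -- A suffix `l` carries the position `0` to `|l|`, so the whole word moves `0` unless it is empty.
  have key : ∀ l p : List (Y × Bool), w = p ++ l →
      ((FreeGroup.lift σ (FreeGroup.mk l) 0 : Fin (w.length + 1)) : ℕ) = l.length := by
    intro l
    induction l with
    | nil => intro p _; rw [← one_eq_mk, _root_.map_one]; rfl
    | cons a l ih =>
      intro p hp
      have ih' := ih (p ++ [a]) (by simp [hp])
      have hlen := congrArg List.length hp
      simp only [List.length_append, List.length_cons] at hlen
      have e : FreeGroup.mk (a :: l) = FreeGroup.mk [a] * FreeGroup.mk l := by rw [mul_mk]; rfl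
      rw [e, _root_.map_mul, Equiv.Perm.mul_apply]
      set i := FreeGroup.lift σ (FreeGroup.mk l) 0 with hi
      let j : Fin (w.length + 1) := ⟨l.length + 1, by omega⟩
      suffices FreeGroup.lift σ (FreeGroup.mk [a]) i = j by rw [this]; rfl
      obtain ⟨y, _ | _⟩ := a
      · have h1 := hσ y j i ⟨p, l, false, hp, Or.inr ⟨rfl, rfl, ih'⟩⟩
        have h2 : FreeGroup.mk [(y, false)] = (of y)⁻¹ := rfl
        rw [h2, _root_.map_inv, lift_apply_of, Equiv.Perm.inv_eq_iff_eq]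
        exact h1.symm
      · have h1 := hσ y i j ⟨p, l, true, hp, Or.inl ⟨rfl, ih', rfl⟩⟩
        have h2 : FreeGroup.mk [(y, true)] = of y := rfl
        rw [h2, lift_apply_of, h1]
  have h0 := key w [] rfl
  have hwx : FreeGroup.mk w = x := mk_toWord
  rw [hwx, h] at h0
  rw [← toWord_eq_nil_iff, ← List.length_eq_zero_iff]
  exact h0.symm

/-- Free groups of finite rank are Hopfian. -/
theorem injective_of_surjective_freeGroup [Finite Y] {f : FreeGroup Y →* FreeGroup Y}
    (hf : Function.Surjective f) : Function.Injective f := by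
  rw [injective_iff_map_eq_one]
  intro x hx
  by_contra hne
  obtain ⟨n, h, hh⟩ := exists_perm_hom_ne_one hne
  have : Finite (FreeGroup Y →* Equiv.Perm (Fin n)) :=
    Finite.of_equiv _ (FreeGroup.lift (α := Y) (β := Equiv.Perm (Fin n)))
  -- Precomposition with the surjection `f` is injective on a finite set of homomorphisms, hence
  -- surjective; so `h` factors through `f` and kills the kernel.
  have hinj : Function.Injective fun k : FreeGroup Y →* Equiv.Perm (Fin n) => k.comp f := by
    intro k k' hkk
    ext1 z
    obtain ⟨y, hy⟩ := hf (of z)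
    rw [← hy]
    exact DFunLike.congr_fun hkk y
  obtain ⟨k, rfl⟩ := (Finite.injective_iff_surjective.1 hinj) h
  exact hh (by simp [hx])

theorem injective_of_range_equiv [Finite Y] {G : Type*} [Group G] {f : FreeGroup Y →* G}
    (e : f.range ≃* FreeGroup Y) : Function.Injective f := by
  have h := injective_of_surjective_freeGroup (f := e.toMonoidHom.comp f.rangeRestrict)
    (e.surjective.comp f.rangeRestrict_surjective)
  intro a b hab
  refine h ?_
  have : f.rangeRestrict a = f.rangeRestrict b := Subtype.ext hab
  simp [this]

end Hopfian

/-! ### Embedding the free product in a free group -/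

section Coprod

variable (H : Type u) [Group H] [IsFreeGroup H] (Y : Type*)

/-- The free product of a free group with `FreeGroup Y`, inside a free group. -/
noncomputable def coprodToFreeGroup :
    Monoid.Coprod H (FreeGroup Y) →* FreeGroup (IsFreeGroup.Generators H ⊕ Y) :=
  Monoid.Coprod.lift
    ((FreeGroup.map Sum.inl).comp (IsFreeGroup.toFreeGroup H).toMonoidHom)
    (FreeGroup.map Sum.inr)

theorem coprodToFreeGroup_inr (a : FreeGroup Y) :
    coprodToFreeGroup H Y (Monoid.Coprod.inr a) = FreeGroup.map Sum.inr a :=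
  Monoid.Coprod.lift_apply_inr _ _ _

theorem coprodToFreeGroup_injective : Function.Injective (coprodToFreeGroup H Y) := by
  let Ψ : FreeGroup (IsFreeGroup.Generators H ⊕ Y) →* Monoid.Coprod H (FreeGroup Y) :=
    FreeGroup.lift (Sum.elim
      (fun i => Monoid.Coprod.inl ((IsFreeGroup.toFreeGroup H).symm (of i)))
      (fun y => Monoid.Coprod.inr (of y)))
  have h1 : Ψ.comp (FreeGroup.map Sum.inl) =
      Monoid.Coprod.inl.comp (IsFreeGroup.toFreeGroup H).symm.toMonoidHom :=
    FreeGroup.ext_hom _ _ fun i => by simp [Ψ]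
  have h2 : Ψ.comp (FreeGroup.map Sum.inr) = Monoid.Coprod.inr :=
    FreeGroup.ext_hom _ _ fun i => by simp [Ψ]
  have h : Ψ.comp (coprodToFreeGroup H Y) = MonoidHom.id _ := by
    refine Monoid.Coprod.hom_ext ?_ ?_
    · ext a
      have := DFunLike.congr_fun h1 (IsFreeGroup.toFreeGroup H a)
      simpa [coprodToFreeGroup] using this
    · ext a
      have := DFunLike.congr_fun h2 (of a)
      simpa [coprodToFreeGroup] using this
  exact Function.LeftInverse.injective (g := Ψ) fun a => DFunLike.congr_fun h a

end Coprod

/-! ### Conjugacy classes of the generators, and generation of the groupoid -/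

theorem eq_of_isConj_of {Y : Type*} {y z : Y} (h : IsConj (of y) (of z)) : y = z := by
  classical
  let f : FreeGroup Y →* Multiplicative ℤ :=
    FreeGroup.lift fun x => Multiplicative.ofAdd (if x = y then 1 else 0)
  have := isConj_iff_eq.1 (MonoidHom.map_isConj f h)
  simp only [f, lift_apply_of, if_true] at this
  by_contra hne
  rw [if_neg (Ne.symm hne)] at this
  exact absurd (Multiplicative.ofAdd.injective this) one_ne_zero

theorem StabilizesT.exists_perm {φ : MulAut (F g p)} (hφ : StabilizesT φ) :
    ∃ π : Equiv.Perm (Fin p), ∀ j, IsConj (φ (of (Gen.t j))) (of (Gen.t (π j))) := by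
  have h1 : ∀ j : Fin p, ∃ i : Fin p, IsConj (φ (of (Gen.t j))) (of (Gen.t i)) := by
    intro j
    have : ConjClasses.map φ.toMonoidHom (ConjClasses.mk (of (Gen.t j))) ∈ tClasses g p := by
      rw [← hφ]
      exact Set.mem_image_of_mem _ ⟨j, rfl⟩
    obtain ⟨i, hi⟩ := this
    exact ⟨i, ConjClasses.mk_eq_mk_iff_isConj.1 hi⟩
  choose f hf using h1
  have hinj : Function.Injective f := by
    intro i j hij
    have h2 : IsConj (φ (of (Gen.t i))) (φ (of (Gen.t j))) :=
      (hf i).trans (hij ▸ (hf j).symm)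
    have h3 := MonoidHom.map_isConj (MulEquiv.symm φ).toMonoidHom h2
    have h4 : IsConj (of (Gen.t i : Gen g p)) (of (Gen.t j)) := by
      have e : ∀ a, (MulEquiv.symm φ).toMonoidHom (φ a) = a := fun a =>
        MulEquiv.symm_apply_apply φ a
      rwa [e, e] at h3
    exact Gen.t.inj (eq_of_isConj_of h4)
  exact ⟨Equiv.ofBijective f (Finite.injective_iff_bijective.1 hinj), hf⟩

theorem listElt_eq_mk (L : List (Letter g p)) : listElt L = FreeGroup.mk L := by
  induction L with
  | nil => rfl
  | cons a L ih => rw [listElt_cons, ih, Letter.elt, mul_mk]; rfl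

theorem IsZieschang.norm_le {V : F g p} (hV : IsZieschang V) :
    FreeGroup.norm V ≤ 4 * g + p := by
  obtain ⟨L, hL, rfl⟩ := isZieschang_iff.1 hV
  rw [listElt_eq_mk, ← hL.length_eq]
  exact norm_mk_le

/-- Any edge is an injective map to which the main result applies with `emb = id`, its target being
spelled by `4g + p` letters. -/
theorem nielsenSubgroupoid_eq_top (g p : ℕ) : nielsenSubgroupoid g p = ⊤ := by
  rw [eq_top_iff, Subgroupoid.le_iff]
  rintro ⟨V, hV⟩ ⟨W, hW⟩ φ -
  obtain ⟨π, hπ⟩ := ZieschangHom.stabilizes φ |>.exists_perm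
  obtain ⟨_, φ', hφ', h⟩ := exists_nielsen_path (emb := id) Function.injective_id
    (θ := (ZieschangHom.aut φ).toMonoidHom) (ZieschangHom.aut φ).injective hV hW.norm_le
    (by rw [map.id]; exact ZieschangHom.map_elt φ) π hπ
  have : φ = φ' := ZieschangHom.ext (MulEquiv.ext fun a => by
    have := h a
    rwa [map.id] at this)
  rw [this]
  exact hφ'

end ZMC

theorem theorem2p1 (g p : ℕ) :
    (∀ (H : Type*) [Group H] [IsFreeGroup H] (V W : ZMC.F g p)
      (φ : Monoid.Coprod H (ZMC.F g p) →* Monoid.Coprod H (ZMC.F g p))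
      (hV : ZMC.IsZieschang V)
      (_ : FreeGroup.norm W ≤ 4 * g + p)
      (_ : φ (Monoid.Coprod.inr V) = Monoid.Coprod.inr W)
      (_ : ∃ π : Equiv.Perm (Fin p), ∀ j : Fin p,
        IsConj (φ (Monoid.Coprod.inr (FreeGroup.of (ZMC.Gen.t j))))
          (Monoid.Coprod.inr (FreeGroup.of (ZMC.Gen.t (π j)))))
      (_ : Nonempty
        ((φ.comp (Monoid.Coprod.inr : ZMC.F g p →* Monoid.Coprod H (ZMC.F g p))).range ≃*
          ZMC.F g p)),
      ∃ (hW : ZMC.IsZieschang W)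
        (φ' : ZMC.ZieschangHom (⟨V, hV⟩ : ZMC.Zieschang g p) ⟨W, hW⟩),
        φ' ∈ (ZMC.nielsenSubgroupoid g p).arrows ⟨V, hV⟩ ⟨W, hW⟩ ∧
        ∀ a : ZMC.F g p, φ (Monoid.Coprod.inr a) = Monoid.Coprod.inr (φ'.aut a)) ∧
    ZMC.nielsenSubgroupoid g p = ⊤ := by
  refine ⟨?_, ZMC.nielsenSubgroupoid_eq_top g p⟩
  rintro H _ _ V W φ hV hn hVW ⟨π, hπ⟩ ⟨e⟩
  -- The hypotheses are pushed into the ambient free group, where reduced words are available, and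
  -- injectivity pulls the conclusion back.
  have hinj := ZMC.coprodToFreeGroup_injective H (ZMC.Gen g p)
  obtain ⟨hW, φ', hφ', h⟩ := ZMC.exists_nielsen_path
    (emb := (Sum.inr : ZMC.Gen g p → IsFreeGroup.Generators H ⊕ ZMC.Gen g p))
    Sum.inr_injective
    (θ := (ZMC.coprodToFreeGroup H (ZMC.Gen g p)).comp (φ.comp Monoid.Coprod.inr))
    (hinj.comp (ZMC.injective_of_range_equiv e)) hV hn
    (by
      rw [← ZMC.coprodToFreeGroup_inr, ← hVW]
      rfl) π (fun j => by
      have := MonoidHom.map_isConj (ZMC.coprodToFreeGroup H (ZMC.Gen g p)) (hπ j)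
      rwa [ZMC.coprodToFreeGroup_inr, FreeGroup.map.of] at this)
  refine ⟨hW, φ', hφ', fun a => hinj ?_⟩
  rw [ZMC.coprodToFreeGroup_inr, ← h]
  rfl
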